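/- **Setting.** Let $r,n,m,q,N$ be natural numbers and let $(A_i,E_i,C_i,D_i,B_i)$, $i=1,\dots,N$, be real matrices of sizes $r\times r$, $r\times n$, $n\times r$, $n\times n$, $n\times m$; let $\mathbb M$ be the convex hull of these $N$ tuples. Let $H\in\mathbb R^{q\times r}$, $J\in\mathbb R^{q\times m}$, and for $\alpha>0$ put $c(\sigma)=\|\sigma\|^{-1/2}+\alpha$. For a plant $(A,E,C,D,B)\in\mathbb M$, gains $K_0\in\mathbb R^{m\times r}$, $K=[K_1\ K_2]\in\mathbb R^{m\times 2n}$ and a disturbance $f:[0,\infty)\to\mathbb R^n$, the closed loop is $$\dot\zeta=A\zeta+E\sigma,\qquad \dot\sigma=C\zeta+D\sigma+Bu+f(t),\qquad \dot\eta=c(\sigma)^2\sigma,\qquad u=K_0\zeta+c(\sigma)K_1\sigma+K_2\eta,$$ with solutions in the sense of Filippov. When $BK_2$ is invertible, put $z=\eta+(BK_2)^{-1}f$ and $x=(\sigma,z)$. The controlled output is $\xi=(H+JK_0)\zeta$. For a given $\gamma>0$, a disturbance is admissible for this plant and these gains if it is differentiable on $[0,\infty)$ and $\|\dot f(t)\|\le\delta$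 for all $t\ge0$, where $\delta=\|(BK_2)^{-1}\|^{-1}\gamma^{-1}$ and $\|\cdot\|$ is the maximum singular value. **Matrix inequalities.** Fix $\gamma,\alpha,\rho>0$ and an initial condition $(\zeta_0,x_0)$, $x_0=(\sigma_0,z_0)\in\mathbb R^{2n}$ (so $z_0=\eta(0)$ if $f(0)=0$). Put $G_0=[I_n\ 0]$, $F_0=[0\ I_n]^T$, $E_0=[\tfrac12 I_n\ 0]^T$, $A_0=\begin{bmatrix}0&0\\ I_n&0\end{bmatrix}$, $B_{0i}=\begin{bmatrix}B_i\\0\end{bmatrix}$, $T=\begin{bmatrix}E_0&F_0&G_0^T&G_0^T\end{bmatrix}^T$, and $Z_d=\mathrm{diag}(\mu I_n,\beta I_n,\pi I_n,\kappa I_n)$ with real scalars $\mu,\beta,\pi,\kappa$. In the variables $\theta\in\mathbb R$, $Q=Q^T\in\mathbb R^{r\times r}$, $X=X^T\in\mathbb R^{2n\times 2n}$, $Y\in\mathbb R^{m\times2n}$, $W\in\mathbb R^{m\times r}$, $Z_d$, consider the following strict inequalities, where $\bullet$ denotes symmetric blocks. For $i=1,\dots,N$: $$\begin{bmatrix}A_0X+B_{0i}Y+XA_0^T+Y^TB_{0i}^T+\rho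 X+T^TZ_dT&\bullet\\ \begin{bmatrix}B_iY\\ \gamma^{-1}G_0X\\ \alpha^{-1}D_iG_0X\\ 0\end{bmatrix}&-Z_d\end{bmatrix}<0,$$ $$\begin{bmatrix}A_iQ+QA_i^T+\rho Q&\bullet&\bullet\\ \alpha^{-1}XG_0^TE_i^T&-\rho X&\bullet\\ HQ+JW&0&-I_q\end{bmatrix}<0,\qquad \begin{bmatrix}\rho Q&\bullet&\bullet\\ C_iQ+B_iW&\kappa I_n&\bullet\\ HQ+JW&0&\alpha I_q\end{bmatrix}>0,$$ and $$\begin{bmatrix}\theta&\bullet\\ \zeta_0&Q\end{bmatrix}>0,\qquad \begin{bmatrix}\theta&\bullet\\ R(\sigma_0)x_0&X\end{bmatrix}>0,\qquad R(\sigma_0)x_0=(c(\sigma_0)\sigma_0,\,z_0),$$ where $c(\sigma)\sigma$ is $0$ at $\sigma=0$. **Theorem.** The problem of minimizing $\theta$ subject to these inequalities is a convex program: the feasible set is convex and the objective is linear. If it is feasible, with infimum $\theta^*$, then for every $\varepsilon>0$ it has a feasible point with $\theta<\theta^*+\varepsilon$. For every feasible point $(\theta,Q,X,Y,W,Z_d)$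 the matrices $Q$ and $X$ are invertible, and the gains $K_0=WQ^{-1}$ and $K=[K_1\ K_2]=YX^{-1}$ have the following properties for every plant $(A,E,C,D,B)\in\mathbb M$. The matrix $BK_2$ is invertible, and for every admissible disturbance: 1. the closed loop is globally asymptotically stable in the coordinates $(\zeta,x)$: the origin is Lyapunov stable, no solution escapes in finite time, and every solution on $[0,\infty)$ converges to $0$; 2. $\theta$ is a guaranteed performance index: every solution on $[0,\infty)$ with $(\zeta,x)(0)=(\zeta_0,x_0)$ satisfies $\int_0^\infty\xi^T\xi\,dt\le\theta$. -/

import Mathlib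

open Set Filter Topology MeasureTheory
open scoped Matrix

noncomputable section

namespace MGSTA

/-! ### Filippov solutions of discontinuous differential equations -/

section Filippov

variable {S : Type*} [NormedAddCommGroup S] [NormedSpace ℝ S] [MeasureSpace S]

/-- Filippov's set-valued regularization of the vector field `F (t, ·)` at the point `x`: the
intersection, over all radii `ε > 0` and all Lebesgue-null sets `M`, of the closed convex hulls
of `F (t, ball x ε \ M)`. -/
def filippovMap (F : ℝ → S → S) (t : ℝ) (x : S) : Set S :=
  ⋂ (ε : ℝ) (_ : 0 < ε) (M : Set S) (_ : volume M = 0),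
    closure (convexHull ℝ (F t '' (Metric.ball x ε \ M)))

/-- `x` is a Filippov solution of `x' = F (t, x)` on `I`, an interval starting at `0`: it is
absolutely continuous on every `[0, b]` with `b ∈ I`, and for almost every `t ∈ I` its derivative
exists and lies in the Filippov regularization of `F`. -/
structure IsFilippovSolution (F : ℝ → S → S) (I : Set ℝ) (x : ℝ → S) : Prop where
  absolutelyContinuous : ∀ b ∈ I, AbsolutelyContinuousOnInterval x 0 b
  deriv_mem : ∀ᵐ t ∂(volume.restrict I), ∃ x' : S, HasDerivAt x x' t ∧ x' ∈ filippovMap F t (x t)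

/-- Global asymptotic stability, in the coordinates `e t x`, of the origin for the Filippov
solutions of `x' = F (t, x)` started at time `0`. -/
structure IsGloballyAsymptoticallyStable (F : ℝ → S → S) (e : ℝ → S → S) : Prop where
  /-- Lyapunov stability. -/
  stable : ∀ ε > 0, ∃ δ > 0, ∀ (T : ℝ) (x : ℝ → S), IsFilippovSolution F (Ico 0 T) x →
    ‖e 0 (x 0)‖ < δ → ∀ t ∈ Ico 0 T, ‖e t (x t)‖ < ε
  /-- No solution escapes to infinity in finite time. -/
  no_escape : ∀ (T : ℝ) (x : ℝ → S), IsFilippovSolution F (Ico 0 T) x →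
    Bornology.IsBounded ((fun t => e t (x t)) '' Ico 0 T)
  /-- Global attractivity. -/
  attractive : ∀ x : ℝ → S, IsFilippovSolution F (Ici 0) x →
    Tendsto (fun t => e t (x t)) atTop (𝓝 0)

end Filippov

/-! ### The plant and the controller -/

/-- The state `(ζ, σ, η)` of the closed loop: plant state `(ζ, σ)` and controller state `η`. -/
abbrev State (r n : ℕ) : Type :=
  EuclideanSpace ℝ (Fin r) × EuclideanSpace ℝ (Fin n) × EuclideanSpace ℝ (Fin n)

/-- The matrix-vector product between Euclidean spaces. -/
def act {k l : ℕ} (M : Matrix (Fin k) (Fin l) ℝ) (v : EuclideanSpace ℝ (Fin l)) :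
    EuclideanSpace ℝ (Fin k) :=
  WithLp.toLp 2 (M *ᵥ v.ofLp)

/-- The maximum singular value (operator norm for the Euclidean norm) of a square matrix. -/
def maxSingularValue {n : ℕ} (M : Matrix (Fin n) (Fin n) ℝ) : ℝ :=
  ‖Matrix.toEuclideanCLM (𝕜 := ℝ) M‖

/-- The gain function `c(σ) = 1 / √‖σ‖ + α`. -/
def c {n : ℕ} (α : ℝ) (σ : EuclideanSpace ℝ (Fin n)) : ℝ := 1 / √‖σ‖ + α

/-- The control law `u = K₀ ζ + c(σ) K₁ σ + K₂ η`, where `K = [K₁ K₂]`. -/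
def control {r n m : ℕ} (α : ℝ) (K₀ : Matrix (Fin m) (Fin r) ℝ)
    (K : Matrix (Fin m) (Fin n ⊕ Fin n) ℝ) (s : State r n) : EuclideanSpace ℝ (Fin m) :=
  act K₀ s.1 + c α s.2.1 • act K.toCols₁ s.2.1 + act K.toCols₂ s.2.2

/-- The right-hand side of the closed loop
`ζ' = A ζ + E σ`, `σ' = C ζ + D σ + B u + f(t)`, `η' = c(σ)² σ`. -/
def closedLoop {r n m : ℕ} (α : ℝ)
    (A : Matrix (Fin r) (Fin r) ℝ) (E : Matrix (Fin r) (Fin n) ℝ)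
    (C : Matrix (Fin n) (Fin r) ℝ) (D : Matrix (Fin n) (Fin n) ℝ) (B : Matrix (Fin n) (Fin m) ℝ)
    (K₀ : Matrix (Fin m) (Fin r) ℝ) (K : Matrix (Fin m) (Fin n ⊕ Fin n) ℝ)
    (f : ℝ → EuclideanSpace ℝ (Fin n)) (t : ℝ) (s : State r n) : State r n :=
  (act A s.1 + act E s.2.1,
   act C s.1 + act D s.2.1 + act B (control α K₀ K s) + f t,
   (c α s.2.1) ^ 2 • s.2.1)

/-- The coordinates `(ζ, x) = (ζ, σ, z)` with `z = η + (B K₂)⁻¹ f(t)`, in which the origin is the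
equilibrium of the closed loop. -/
def shifted {r n m : ℕ} (B : Matrix (Fin n) (Fin m) ℝ) (K : Matrix (Fin m) (Fin n ⊕ Fin n) ℝ)
    (f : ℝ → EuclideanSpace ℝ (Fin n)) (t : ℝ) (s : State r n) : State r n :=
  (s.1, s.2.1, s.2.2 + act (B * K.toCols₂)⁻¹ (f t))

/-- The admissible disturbances: `f` is differentiable on `[0, ∞)` and `‖f'(t)‖ ≤ δ` there. -/
def IsDisturbance {n : ℕ} (δ : ℝ) (f : ℝ → EuclideanSpace ℝ (Fin n)) : Prop :=
  DifferentiableOn ℝ f (Ici 0) ∧ ∀ t, 0 ≤ t → ‖derivWithin f (Ici 0) t‖ ≤ δ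

/-- The bound `δ = ‖(B K₂)⁻¹‖⁻¹ γ⁻¹` on the derivative of the disturbance. -/
def disturbanceBound {n m : ℕ} (γ : ℝ) (B : Matrix (Fin n) (Fin m) ℝ)
    (K : Matrix (Fin m) (Fin n ⊕ Fin n) ℝ) : ℝ :=
  (maxSingularValue (B * K.toCols₂)⁻¹)⁻¹ * γ⁻¹

/-- `θ` is a guaranteed cost for the initial condition `(ζ₀, x₀)`, `x₀ = (σ₀, z₀)`: along every
solution issued from it, the controlled output `ξ = (H + J K₀) ζ` has `∫₀^∞ ξᵀ ξ dt ≤ θ`. -/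
def HasGuaranteedCost {r n m q : ℕ} (F : ℝ → State r n → State r n)
    (e : ℝ → State r n → State r n)
    (H : Matrix (Fin q) (Fin r) ℝ) (J : Matrix (Fin q) (Fin m) ℝ) (K₀ : Matrix (Fin m) (Fin r) ℝ)
    (ζ₀ : EuclideanSpace ℝ (Fin r)) (σ₀ z₀ : EuclideanSpace ℝ (Fin n)) (θ : ℝ) : Prop :=
  ∀ s : ℝ → State r n, IsFilippovSolution F (Ici 0) s → e 0 (s 0) = (ζ₀, σ₀, z₀) →
    IntegrableOn (fun t => ‖act (H + J * K₀) (s t).1‖ ^ 2) (Ioi 0) ∧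
    ∫ t in Ioi (0 : ℝ), ‖act (H + J * K₀) (s t).1‖ ^ 2 ≤ θ

/-! ### The linear matrix inequalities

Vectors of `ℝ²ⁿ` are indexed by `Fin n ⊕ Fin n`. The block diagonal matrix `Z_d` is given by its
four scalars `z = (μ, β, π, κ)`. -/

/-- `A₀ = [0 0; I 0]`. -/
def A₀ (n : ℕ) : Matrix (Fin n ⊕ Fin n) (Fin n ⊕ Fin n) ℝ := Matrix.fromBlocks 0 0 1 0

/-- `B₀ = [B; 0]`. -/
def B₀ {n m : ℕ} (B : Matrix (Fin n) (Fin m) ℝ) : Matrix (Fin n ⊕ Fin n) (Fin m) ℝ :=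
  Matrix.fromRows B 0

/-- `E₀ = [(1/2) I; 0]`. -/
def E₀ (n : ℕ) : Matrix (Fin n ⊕ Fin n) (Fin n) ℝ := Matrix.fromRows ((1 / 2 : ℝ) • 1) 0

/-- `F₀ = [0; I]`. -/
def F₀ (n : ℕ) : Matrix (Fin n ⊕ Fin n) (Fin n) ℝ := Matrix.fromRows 0 1

/-- `G₀ = [I 0]`. -/
def G₀ (n : ℕ) : Matrix (Fin n) (Fin n ⊕ Fin n) ℝ := Matrix.fromCols 1 0

/-- Four blocks of rows on top of each other. -/
def stack {n : ℕ} {ι : Type*} (M₁ M₂ M₃ M₄ : Matrix (Fin n) ι ℝ) : Matrix (Fin 4 × Fin n) ι ℝ :=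
  Matrix.of fun p j => (![M₁, M₂, M₃, M₄] p.1) p.2 j

/-- `Z_d = diag(μ I, β I, π I, κ I)`, where `z = (μ, β, π, κ)`. -/
def Zd (n : ℕ) (z : Fin 4 → ℝ) : Matrix (Fin 4 × Fin n) (Fin 4 × Fin n) ℝ :=
  Matrix.diagonal fun p => z p.1

/-- The stack `[E₀ᵀ; F₀ᵀ; G₀; G₀]`. -/
def T₀ (n : ℕ) : Matrix (Fin 4 × Fin n) (Fin n ⊕ Fin n) ℝ :=
  stack (E₀ n)ᵀ (F₀ n)ᵀ (G₀ n) (G₀ n)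

/-- The stack `[B Y; γ⁻¹ G₀ X; α⁻¹ D G₀ X; 0]`. -/
def stackXY {n m : ℕ} (γ α : ℝ) (D : Matrix (Fin n) (Fin n) ℝ) (B : Matrix (Fin n) (Fin m) ℝ)
    (X : Matrix (Fin n ⊕ Fin n) (Fin n ⊕ Fin n) ℝ) (Y : Matrix (Fin m) (Fin n ⊕ Fin n) ℝ) :
    Matrix (Fin 4 × Fin n) (Fin n ⊕ Fin n) ℝ :=
  stack (B * Y) (γ⁻¹ • (G₀ n * X)) (α⁻¹ • (D * G₀ n * X)) 0

/-- The matrix of the vertex inequality for the nonlinear subsystem (required to be `< 0`). -/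
def lmiN {n m : ℕ} (γ α ρ : ℝ) (D : Matrix (Fin n) (Fin n) ℝ) (B : Matrix (Fin n) (Fin m) ℝ)
    (X : Matrix (Fin n ⊕ Fin n) (Fin n ⊕ Fin n) ℝ) (Y : Matrix (Fin m) (Fin n ⊕ Fin n) ℝ)
    (z : Fin 4 → ℝ) :
    Matrix ((Fin n ⊕ Fin n) ⊕ (Fin 4 × Fin n)) ((Fin n ⊕ Fin n) ⊕ (Fin 4 × Fin n)) ℝ :=
  Matrix.fromBlocks
    (A₀ n * X + B₀ B * Y + X * (A₀ n)ᵀ + Yᵀ * (B₀ B)ᵀ + ρ • X + (T₀ n)ᵀ * Zd n z * T₀ n)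
    (stackXY γ α D B X Y)ᵀ
    (stackXY γ α D B X Y)
    (-Zd n z)

/-- The matrix of the vertex inequality for the linear subsystem (required to be `< 0`). -/
def lmiL {r n m q : ℕ} (α ρ : ℝ) (H : Matrix (Fin q) (Fin r) ℝ) (J : Matrix (Fin q) (Fin m) ℝ)
    (A : Matrix (Fin r) (Fin r) ℝ) (E : Matrix (Fin r) (Fin n) ℝ)
    (Q : Matrix (Fin r) (Fin r) ℝ) (X : Matrix (Fin n ⊕ Fin n) (Fin n ⊕ Fin n) ℝ)
    (W : Matrix (Fin m) (Fin r) ℝ) :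
    Matrix ((Fin r ⊕ (Fin n ⊕ Fin n)) ⊕ Fin q) ((Fin r ⊕ (Fin n ⊕ Fin n)) ⊕ Fin q) ℝ :=
  Matrix.fromBlocks
    (Matrix.fromBlocks
      (A * Q + Q * Aᵀ + ρ • Q) (α⁻¹ • (X * (G₀ n)ᵀ * Eᵀ))ᵀ
      (α⁻¹ • (X * (G₀ n)ᵀ * Eᵀ)) (-(ρ • X)))
    (Matrix.fromCols (H * Q + J * W) 0)ᵀ
    (Matrix.fromCols (H * Q + J * W) 0)
    (-1)

/-- The matrix of the vertex inequality coupling the two subsystems (required to be `> 0`). -/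
def lmiC {r n m q : ℕ} (α ρ : ℝ) (H : Matrix (Fin q) (Fin r) ℝ) (J : Matrix (Fin q) (Fin m) ℝ)
    (C : Matrix (Fin n) (Fin r) ℝ) (B : Matrix (Fin n) (Fin m) ℝ)
    (Q : Matrix (Fin r) (Fin r) ℝ) (W : Matrix (Fin m) (Fin r) ℝ) (κ : ℝ) :
    Matrix ((Fin r ⊕ Fin n) ⊕ Fin q) ((Fin r ⊕ Fin n) ⊕ Fin q) ℝ :=
  Matrix.fromBlocks
    (Matrix.fromBlocks (ρ • Q) (C * Q + B * W)ᵀ (C * Q + B * W) (κ • 1))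
    (Matrix.fromCols (H * Q + J * W) 0)ᵀ
    (Matrix.fromCols (H * Q + J * W) 0)
    (α • 1)

/-- The bordered matrix `[θ vᵀ; v M]`. -/
def bordered {ι : Type*} (θ : ℝ) (v : ι → ℝ) (M : Matrix ι ι ℝ) :
    Matrix (Unit ⊕ ι) (Unit ⊕ ι) ℝ :=
  Matrix.fromBlocks (Matrix.of fun _ _ => θ) (Matrix.replicateRow Unit v)
    (Matrix.replicateCol Unit v) M

/-- The vector `R(σ) x = (c(σ) σ, z)` for `x = (σ, z)`. -/
def Rx {n : ℕ} (α : ℝ) (σ z : EuclideanSpace ℝ (Fin n)) : Fin n ⊕ Fin n → ℝ :=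
  Sum.elim (fun i => c α σ * σ i) (fun i => z i)

/-- The decision variables `(θ, Q, X, Y, W, z)`, where `z = (μ, β, π, κ)` stands for `Z_d`. -/
abbrev Variables (r n m : ℕ) : Type :=
  ℝ × Matrix (Fin r) (Fin r) ℝ × Matrix (Fin n ⊕ Fin n) (Fin n ⊕ Fin n) ℝ ×
    Matrix (Fin m) (Fin n ⊕ Fin n) ℝ × Matrix (Fin m) (Fin r) ℝ × (Fin 4 → ℝ)

/-- The feasible set of the minimization of `θ` under the linear matrix inequalities, for the
vertices `(A i, E i, C i, D i, B i)` and the initial condition `(ζ₀, x₀)`, `x₀ = (σ₀, z₀)`.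
Positive definite matrices are symmetric by definition; that `θ`, `Q` and `X` are positive is
contained in the last two constraints. -/
def feasibleSet {r n m q N : ℕ} (γ α ρ : ℝ)
    (A : Fin N → Matrix (Fin r) (Fin r) ℝ) (E : Fin N → Matrix (Fin r) (Fin n) ℝ)
    (C : Fin N → Matrix (Fin n) (Fin r) ℝ) (D : Fin N → Matrix (Fin n) (Fin n) ℝ)
    (B : Fin N → Matrix (Fin n) (Fin m) ℝ)
    (H : Matrix (Fin q) (Fin r) ℝ) (J : Matrix (Fin q) (Fin m) ℝ)
    (ζ₀ : EuclideanSpace ℝ (Fin r)) (σ₀ z₀ : EuclideanSpace ℝ (Fin n)) :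
    Set (Variables r n m) :=
  {p | match p with
    | (θ, Q, X, Y, W, z) =>
      (∀ i, (-lmiN γ α ρ (D i) (B i) X Y z).PosDef) ∧
      (∀ i, (-lmiL α ρ H J (A i) (E i) Q X W).PosDef) ∧
      (∀ i, (lmiC α ρ H J (C i) (B i) Q W (z 3)).PosDef) ∧
      (bordered θ (fun i => ζ₀ i) Q).PosDef ∧
      (bordered θ (Rx α σ₀ z₀) X).PosDef}

/-- The polytope of plants `(A, E, C, D, B)` generated by the vertices. -/
def polytope {r n m N : ℕ}
    (A : Fin N → Matrix (Fin r) (Fin r) ℝ) (E : Fin N → Matrix (Fin r) (Fin n) ℝ)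
    (C : Fin N → Matrix (Fin n) (Fin r) ℝ) (D : Fin N → Matrix (Fin n) (Fin n) ℝ)
    (B : Fin N → Matrix (Fin n) (Fin m) ℝ) :
    Set (Matrix (Fin r) (Fin r) ℝ × Matrix (Fin r) (Fin n) ℝ × Matrix (Fin n) (Fin r) ℝ ×
      Matrix (Fin n) (Fin n) ℝ × Matrix (Fin n) (Fin m) ℝ) :=
  convexHull ℝ (range fun i => (A i, E i, C i, D i, B i))

end MGSTA

end

/-!
The proof is a Lyapunov argument in the coordinates `(ζ, χ)`, where `χ = (c(σ) σ, z)` and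
`z = η + (B K₂)⁻¹ f`. For a feasible point put `V = max (ζᵀ Q⁻¹ ζ) (χᵀ X⁻¹ χ)`. Along every
solution, `V(t) + ∫₀ᵗ (‖ξ‖² + ω V)` is nonincreasing for some `ω > 0`. This gives stability and
boundedness because `V` is continuous and coercive, convergence because a nonincreasing integrable
function tends to zero, and the cost bound because `∫ ‖ξ‖² ≤ V(0)`, while the two bordered
inequalities say `V(0) ≤ θ`.

*The matrix inequalities.* They are affine in the plant and in the unknowns, which gives the
convexity of the feasible set and passes from the vertices to the polytope. Evaluated on suitable
vectors they become dissipation inequalities (`exists_lmiL_dissipation`,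
`exists_lmiN_dissipation`, `lmiC_le`): `ζᵀ Q⁻¹ ζ` decays where it is the larger of the
two forms, and `χᵀ X⁻¹ χ` decays where it is the larger one, for every perturbation of the linear
field that respects some norm bounds. The structure `Certificate` collects what is used afterwards.

*Away from `σ = 0`* the curve `χ` is differentiable and `χ' = c(σ) (linear field in χ +
perturbation)`. The perturbation collects the derivative of the scalar factor `c(σ)`, the terms in
`ζ` and `σ`, and `(B K₂)⁻¹ f'`; as `c(σ)² ‖σ‖ ≥ 1`, the last is bounded by `γ⁻¹ ‖c(σ) σ‖`. Since
`c(σ) ≥ α`, the dissipation inequality applies (`Certificate.exists_hasDerivAt_bx`).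

*At `σ = 0`* the regularized vector field is set-valued in the last component only, and `V` fails to
be Lipschitz, so that `V` along a solution need not be absolutely continuous there. The proof
therefore uses Dini derivatives: a continuous function whose upper right Dini derivative is bounded
above, and nonpositive almost everywhere, is nonincreasing (`le_of_ae_eventually_sub_le`). The bound
comes from comparing `V(s)` with its value at the last zero of `σ` before `s`. At almost every zero
of `σ`, either `σ' ≠ 0` and the zero is isolated, or `σ' = 0`; in the second case the dissipation
inequality for `χ` with the perturbation `-(linear field)` shows that the first quadratic form
dominates strictly, or that the state is the origin (`Certificate.eq_zero_of_sliding`). The same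
argument at `ζ = 0` shows that `B K₂` is injective.
-/

noncomputable section

namespace MGSTA

/-! ### Monotonicity from Dini derivatives, and absolute continuity -/

/-- The case of `le_of_ae_eventually_sub_le` in which the bounds also hold at the left endpoint. -/
theorem le_of_forall_Ico_eventually_sub_le {φ : ℝ → ℝ} {a b C : ℝ} (hab : a ≤ b) (hC0 : 0 ≤ C)
    (hφ : ContinuousOn φ (Icc a b)) {N : Set ℝ} (hN : volume N = 0)
    (hC : ∀ t ∈ Ico a b, ∀ᶠ s in 𝓝[>] t, φ s - φ t ≤ C * (s - t))
    (h0 : ∀ t ∈ Ico a b, t ∉ N → ∀ r > 0, ∀ᶠ s in 𝓝[>] t, φ s - φ t ≤ r * (s - t)) :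
    φ b ≤ φ a := by
  have key : ∀ ε > 0, φ b ≤ φ a + (C + (b - a)) * ε := by
    intro ε hε
    obtain ⟨O, hNO, hO, hOε⟩ := N.exists_isOpen_lt_of_lt (ENNReal.ofReal ε)
      (by rw [hN]; simpa using hε)
    -- the measure of the part of `O` to the left of `t`
    set m : ℝ → ℝ := fun t => volume.real (O ∩ Ioc a t) with hm
    have hfin : ∀ s t, volume (O ∩ Ioc s t) ≠ ⊤ := fun s t =>
      ((measure_mono inter_subset_right).trans_lt measure_Ioc_lt_top).ne
    have hadd : ∀ s t, a ≤ s → s ≤ t → m t = m s + volume.real (O ∩ Ioc s t) := by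
      intro s t has hst
      rw [hm]
      simp only
      rw [← measureReal_union, ← inter_union_distrib_left, Ioc_union_Ioc_eq_Ioc has hst]
      · exact (Ioc_disjoint_Ioc_of_le le_rfl).mono inter_subset_right inter_subset_right
      · exact hO.measurableSet.inter measurableSet_Ioc
    have hle : ∀ s t, s ≤ t → volume.real (O ∩ Ioc s t) ≤ t - s := by
      intro s t hst
      refine (measureReal_mono inter_subset_right measure_Ioc_lt_top.ne).trans ?_
      simp [measureReal_def, hst]
    have hmcont : ContinuousOn m (Icc a b) := by
      have : LipschitzOnWith 1 m (Icc a b) := by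
        refine LipschitzOnWith.of_le_add fun x hx y hy => ?_
        rcases le_total x y with h | h
        · rw [hadd x y hx.1 h]
          have : (0 : ℝ) ≤ volume.real (O ∩ Ioc x y) := measureReal_nonneg
          linarith [dist_nonneg (x := x) (y := y)]
        · rw [hadd y x hy.1 h, Real.dist_eq, abs_of_nonneg (by linarith)]
          linarith [hle y x h]
      exact this.continuousOn
    have main := image_le_of_liminf_slope_right_le_deriv_boundary
      (f := fun t => φ t - C * m t) (a := a) (b := b) (B := fun t => φ a + ε * (t - a))
      (B' := fun _ => ε) (hφ.sub (hmcont.const_smul C)) (by simp [hm]) (by fun_prop)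
      (fun x _ => by
        simpa using
          ((((hasDerivAt_id x).sub_const a).const_mul ε).const_add (φ a)).hasDerivWithinAt)
      (fun t ht r hr => ?_) (right_mem_Icc.2 hab)
    · have h1 : m b ≤ ε := by
        refine (measureReal_mono inter_subset_left (hOε.trans ENNReal.ofReal_lt_top).ne).trans ?_
        exact ENNReal.toReal_le_of_le_ofReal hε.le hOε.le
      have := mul_le_mul_of_nonneg_left h1 hC0
      linarith
    · apply Eventually.frequently
      have hpos : ∀ᶠ s in 𝓝[>] t, t < s := self_mem_nhdsWithin
      by_cases htN : t ∈ N
      · obtain ⟨δ, hδ, hball⟩ := Metric.isOpen_iff.1 hO t (hNO htN)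
        have hnear : ∀ᶠ s in 𝓝[>] t, s < t + δ :=
          mem_nhdsWithin_of_mem_nhds (Iio_mem_nhds (by linarith))
        filter_upwards [hC t ht, hpos, hnear] with s hs hts hsδ
        have hsub : O ∩ Ioc t s = Ioc t s := inter_eq_right.2 fun y hy => hball (by
          rw [Metric.mem_ball, Real.dist_eq, abs_of_nonneg (by linarith [hy.1])]
          linarith [hy.2])
        have h2 := hadd t s ht.1 hts.le
        rw [hsub] at h2
        have h3 : volume.real (Ioc t s) = s - t := by simp [measureReal_def, hts.le]
        rw [h3] at h2
        have : slope (fun t => φ t - C * m t) t s ≤ 0 := by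
          rw [slope_def_field]
          apply div_nonpos_of_nonpos_of_nonneg _ (by linarith)
          rw [h2]; linarith
        linarith
      · filter_upwards [h0 t ht htN ε hε, hpos] with s hs hts
        have h2 := hadd t s ht.1 hts.le
        have h3 : (0 : ℝ) ≤ C * volume.real (O ∩ Ioc t s) := mul_nonneg hC0 measureReal_nonneg
        have : slope (fun t => φ t - C * m t) t s ≤ ε := by
          rw [slope_def_field, div_le_iff₀ (by linarith), h2]
          linarith
        linarith
  have hC1 : 0 < C + (b - a) + 1 := by linarith
  refine le_of_forall_pos_le_add fun η hη => ?_
  have := key (η / (C + (b - a) + 1)) (by positivity)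
  refine this.trans ?_
  have h5 : (C + (b - a)) * (η / (C + (b - a) + 1)) ≤ η := by
    rw [mul_div_assoc', div_le_iff₀ hC1]; nlinarith
  linarith

/-- A continuous function is nonincreasing over `[a, b]` if its upper right Dini derivative is
bounded above everywhere and nonpositive outside a null set: on a null set covered by an open set
of small measure, the bound can be absorbed by the indefinite integral of its indicator. -/
theorem le_of_ae_eventually_sub_le {φ : ℝ → ℝ} {a b C : ℝ} (hab : a ≤ b)
    (hφ : ContinuousOn φ (Icc a b)) {N : Set ℝ} (hN : volume N = 0)
    (hC : ∀ t ∈ Ioo a b, ∀ᶠ s in 𝓝[>] t, φ s - φ t ≤ C * (s - t))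
    (h0 : ∀ t ∈ Ioo a b, t ∉ N → ∀ r > 0, ∀ᶠ s in 𝓝[>] t, φ s - φ t ≤ r * (s - t)) :
    φ b ≤ φ a := by
  rcases hab.eq_or_lt with rfl | hlt
  · rfl
  have h1 : ∀ a' ∈ Ioo a b, φ b ≤ φ a' := by
    intro a' ha'
    refine le_of_forall_Ico_eventually_sub_le (C := |C|) ha'.2.le (abs_nonneg C)
      (hφ.mono (Icc_subset_Icc_left ha'.1.le)) hN (fun t ht => ?_)
      fun t ht => h0 t ⟨ha'.1.trans_le ht.1, ht.2⟩
    filter_upwards [hC t ⟨ha'.1.trans_le ht.1, ht.2⟩, self_mem_nhdsWithin] with s hs hts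
    have : t < s := hts
    exact hs.trans (mul_le_mul_of_nonneg_right (le_abs_self C) (by linarith))
  have h2 : Tendsto φ (𝓝[>] a) (𝓝 (φ a)) := by
    have := (hφ a (left_mem_Icc.2 hab)).mono Ioo_subset_Icc_self
    rwa [ContinuousWithinAt, nhdsWithin_Ioo_eq_nhdsGT hlt] at this
  exact ge_of_tendsto h2 (by
    filter_upwards [Ioo_mem_nhdsGT hlt] with t ht using h1 t ht)

/-- Postcomposition with a continuous linear functional preserves absolute continuity. -/
theorem absolutelyContinuousOnInterval_clm_comp {S : Type*} [NormedAddCommGroup S]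
    [NormedSpace ℝ S] (ℓ : S →L[ℝ] ℝ) {x : ℝ → S} {a b : ℝ}
    (hx : AbsolutelyContinuousOnInterval x a b) :
    AbsolutelyContinuousOnInterval (fun t => ℓ (x t)) a b := by
  refine squeeze_zero (fun _ => Finset.sum_nonneg fun _ _ => dist_nonneg) (fun E => ?_)
    (by simpa using Tendsto.const_mul ‖ℓ‖ hx)
  rw [Finset.mul_sum]
  gcongr
  rw [Real.dist_eq, dist_eq_norm, ← map_sub]
  exact ℓ.le_opNorm _

/-- An absolutely continuous curve with almost everywhere bounded derivative is Lipschitz. -/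
theorem norm_sub_le_of_absolutelyContinuousOnInterval {S : Type*} [NormedAddCommGroup S]
    [NormedSpace ℝ S] {x : ℝ → S} {a b C : ℝ} (hC : 0 ≤ C)
    (hx : AbsolutelyContinuousOnInterval x a b)
    (hd : ∀ᵐ t, t ∈ Ioo a b → ∃ x', HasDerivAt x x' t ∧ ‖x'‖ ≤ C) :
    ∀ s ∈ Icc a b, ∀ t ∈ Icc a b, ‖x t - x s‖ ≤ C * |t - s| := by
  intro s hs t ht
  refine NormedSpace.norm_le_dual_bound ℝ _ (by positivity) fun ℓ => ?_
  have hsub : uIcc s t ⊆ uIcc a b := by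
    rw [uIcc_of_le (hs.1.trans hs.2)]
    exact uIcc_subset_Icc hs ht
  have hac := (absolutelyContinuousOnInterval_clm_comp ℓ hx).mono hsub
  rw [map_sub, ← hac.integral_deriv_eq_sub]
  have := intervalIntegral.norm_integral_le_of_norm_le_const_ae
    (f := fun u => deriv (fun t => ℓ (x t)) u) (C := C * ‖ℓ‖) (a := s) (b := t) ?_
  · calc _ ≤ _ := this
      _ = _ := by ring
  · have hb : ∀ᵐ u : ℝ, u ≠ b := by simp [ae_iff, measure_singleton]
    filter_upwards [hd, hb] with u hu hub hust
    have hu1 : u ∈ Ioc a b := by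
      rcases le_total s t with h | h
      · rw [uIoc_of_le h] at hust
        exact ⟨hs.1.trans_lt hust.1, hust.2.trans ht.2⟩
      · rw [uIoc_of_ge h] at hust
        exact ⟨ht.1.trans_lt hust.1, hust.2.trans hs.2⟩
    obtain ⟨x', hx', hb'⟩ := hu ⟨hu1.1, lt_of_le_of_ne hu1.2 hub⟩
    have h3 := (ℓ.hasFDerivAt.comp_hasDerivAt u hx').deriv
    simp only [Function.comp_def] at h3
    rw [h3, mul_comm]
    exact (ℓ.le_opNorm x').trans (mul_le_mul_of_nonneg_left hb' (norm_nonneg _))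

/-! ### The nonlinear coordinate `c(σ) σ` -/

section Gain

open scoped RealInnerProductSpace

variable {n : ℕ} {α : ℝ}

theorem c_pos (hα : 0 < α) (σ : EuclideanSpace ℝ (Fin n)) : 0 < c α σ := by
  unfold c; positivity

theorem le_c (α : ℝ) (σ : EuclideanSpace ℝ (Fin n)) : α ≤ c α σ := by
  unfold c; linarith [show 0 ≤ 1 / √‖σ‖ by positivity]

theorem norm_c_smul (hα : 0 < α) (σ : EuclideanSpace ℝ (Fin n)) :
    ‖c α σ • σ‖ = √‖σ‖ + α * ‖σ‖ := by
  rw [norm_smul, Real.norm_of_nonneg (c_pos hα σ).le, c, add_mul, one_div_mul_eq_div,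
    Real.div_sqrt]

theorem norm_c_sq_smul (hα : 0 < α) {σ : EuclideanSpace ℝ (Fin n)} (hσ : σ ≠ 0) :
    ‖c α σ ^ 2 • σ‖ = (1 + α * √‖σ‖) ^ 2 := by
  have h : 0 < √‖σ‖ := Real.sqrt_pos.2 (norm_pos_iff.2 hσ)
  rw [norm_smul, norm_pow, Real.norm_of_nonneg (c_pos hα σ).le, c]
  nth_rewrite 2 [← Real.sq_sqrt (norm_nonneg σ)]
  field_simp

theorem continuous_c_smul (hα : 0 < α) :
    Continuous fun σ : EuclideanSpace ℝ (Fin n) => c α σ • σ := by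
  rw [continuous_iff_continuousAt]
  intro σ
  by_cases hσ : σ = 0
  · subst hσ
    rw [ContinuousAt, smul_zero, tendsto_zero_iff_norm_tendsto_zero]
    simp_rw [norm_c_smul hα]
    have : Continuous fun σ : EuclideanSpace ℝ (Fin n) => √‖σ‖ + α * ‖σ‖ := by fun_prop
    simpa using this.tendsto 0
  · have : √‖σ‖ ≠ 0 := (Real.sqrt_pos.2 (norm_pos_iff.2 hσ)).ne'
    unfold c
    fun_prop (disch := exact this)

/-- Away from the origin, `σ ↦ c(σ) σ` is Lipschitz. -/
theorem norm_c_smul_sub_le (hα : 0 < α) {m : ℝ} (hm : 0 < m) {u v : EuclideanSpace ℝ (Fin n)}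
    (hu : m ≤ ‖u‖) (hv : m ≤ ‖v‖) :
    ‖c α u • u - c α v • v‖ ≤ (2 / √m + α) * ‖u - v‖ := by
  have hm' : 0 < √m := Real.sqrt_pos.2 hm
  have hpu : √m ≤ √‖u‖ := Real.sqrt_le_sqrt hu
  have hpv : √m ≤ √‖v‖ := Real.sqrt_le_sqrt hv
  have hu0 : 0 < √‖u‖ := hm'.trans_le hpu
  have hv0 : 0 < √‖v‖ := hm'.trans_le hpv
  have hsu := Real.mul_self_sqrt (norm_nonneg u)
  have hsv := Real.mul_self_sqrt (norm_nonneg v)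
  have e : c α u • u - c α v • v
      = (1 / √‖u‖) • (u - v) + (1 / √‖u‖ - 1 / √‖v‖) • v + α • (u - v) := by
    unfold c; module
  have h1 : ‖(1 / √‖u‖) • (u - v)‖ ≤ 1 / √m * ‖u - v‖ := by
    rw [norm_smul, Real.norm_of_nonneg (by positivity)]; gcongr
  have h3 : ‖α • (u - v)‖ = α * ‖u - v‖ := by rw [norm_smul, Real.norm_of_nonneg hα.le]
  have h2 : ‖(1 / √‖u‖ - 1 / √‖v‖) • v‖ ≤ 1 / √m * ‖u - v‖ := by
    have e2 : (1 / √‖u‖ - 1 / √‖v‖) * ‖v‖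
        = (‖v‖ - ‖u‖) * (√‖v‖ / (√‖u‖ * (√‖u‖ + √‖v‖))) := by
      have aux : ∀ p q : ℝ, 0 < p → 0 < q →
          (1 / p - 1 / q) * (q * q) = (q * q - p * p) * (q / (p * (p + q))) := by
        intro p q hp hq
        field_simp
        ring
      simpa only [hsu, hsv] using aux _ _ hu0 hv0
    rw [norm_smul, ← abs_of_nonneg (norm_nonneg v), ← Real.norm_eq_abs, ← norm_mul,
      Real.norm_eq_abs]
    simp only [Real.norm_eq_abs, abs_norm]
    rw [e2, abs_mul, abs_of_nonneg (by positivity : 0 ≤ √‖v‖ / (√‖u‖ * (√‖u‖ + √‖v‖))), mul_comm]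
    have h4 : |‖v‖ - ‖u‖| ≤ ‖u - v‖ := by rw [norm_sub_rev]; exact abs_norm_sub_norm_le v u
    have h5 : √‖v‖ / (√‖u‖ * (√‖u‖ + √‖v‖)) ≤ 1 / √m := by
      rw [div_le_div_iff₀ (by positivity) hm']
      nlinarith
    gcongr
  rw [e]
  refine (norm_add₃_le).trans ?_
  rw [h3]
  calc _ ≤ 1 / √m * ‖u - v‖ + 1 / √m * ‖u - v‖ + α * ‖u - v‖ := by gcongr
    _ = _ := by ring

/-- Removing at most half of the component along `σ` does not increase the norm. -/
theorem norm_sub_proj_le (σ v : EuclideanSpace ℝ (Fin n)) {l : ℝ} (h0 : 0 ≤ l) (h1 : l ≤ 1) :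
    ‖v - (l / 2) • (⟪σ, v⟫ / ‖σ‖ ^ 2) • σ‖ ≤ ‖v‖ := by
  by_cases hσ : σ = 0
  · simp [hσ]
  have hs : 0 < ‖σ‖ := norm_pos_iff.2 hσ
  refine le_of_sq_le_sq ?_ (norm_nonneg _)
  rw [@norm_sub_sq_real, norm_smul, norm_smul, inner_smul_right, inner_smul_right,
    real_inner_comm σ v]
  have e : (‖l / 2‖ * (‖⟪σ, v⟫ / ‖σ‖ ^ 2‖ * ‖σ‖)) ^ 2
      = (l ^ 2 / 4) * (⟪σ, v⟫ ^ 2 / ‖σ‖ ^ 2) := by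
    simp only [Real.norm_eq_abs, mul_pow, sq_abs]
    field_simp
    norm_num
    ring
  have e2 : l / 2 * (⟪σ, v⟫ / ‖σ‖ ^ 2 * ⟪σ, v⟫) = l / 2 * (⟪σ, v⟫ ^ 2 / ‖σ‖ ^ 2) := by ring
  rw [e]
  simp only [real_inner_comm v σ] at *
  rw [e2]
  have : 0 ≤ ⟪v, σ⟫ ^ 2 / ‖σ‖ ^ 2 := by positivity
  nlinarith [mul_nonneg (mul_nonneg h0 (by linarith : 0 ≤ 1 - l / 4)) this]

theorem norm_proj_le (σ v : EuclideanSpace ℝ (Fin n)) {l : ℝ} (h0 : 0 ≤ l) (h1 : l ≤ 1) :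
    ‖-(l • (⟪σ, v⟫ / ‖σ‖ ^ 2) • σ)‖ ≤ ‖v‖ := by
  by_cases hσ : σ = 0
  · simp [hσ]
  have hs : 0 < ‖σ‖ := norm_pos_iff.2 hσ
  rw [norm_neg, norm_smul, norm_smul, norm_div, Real.norm_of_nonneg h0, norm_pow, norm_norm]
  have : ‖⟪σ, v⟫‖ / ‖σ‖ ^ 2 * ‖σ‖ ≤ ‖v‖ := by
    rw [div_mul_eq_mul_div, div_le_iff₀ (by positivity)]
    have := norm_inner_le_norm (𝕜 := ℝ) σ v
    nlinarith
  calc _ ≤ 1 * ‖v‖ := by gcongr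
    _ = _ := one_mul _

/-- The scalar factor contributes a multiple of the projection of `σ'` on `σ`; the coefficient is
half of `‖σ‖ ^ (-1 / 2) / c(σ) ∈ [0, 1]`. -/
theorem hasDerivAt_c_smul (hα : 0 < α) {σ : ℝ → EuclideanSpace ℝ (Fin n)}
    {σ' : EuclideanSpace ℝ (Fin n)} {t : ℝ} (h : HasDerivAt σ σ' t) (h0 : σ t ≠ 0) :
    HasDerivAt (fun s => c α (σ s) • σ s)
      (c α (σ t) • (σ' - ((1 / √‖σ t‖ / c α (σ t)) / 2) •
        (⟪σ t, σ'⟫ / ‖σ t‖ ^ 2) • σ t)) t := by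
  have hs : 0 < ‖σ t‖ := norm_pos_iff.2 h0
  have hr : 0 < √‖σ t‖ := Real.sqrt_pos.2 hs
  have hsq := Real.sq_sqrt hs.le
  have h1 : HasDerivAt (fun s => ‖σ s‖ ^ 2) (2 * ⟪σ t, σ'⟫) t := h.norm_sq
  have h2 : HasDerivAt (fun s => ‖σ s‖) (⟪σ t, σ'⟫ / ‖σ t‖) t := by
    have := h1.sqrt (by positivity)
    simp only [Real.sqrt_sq (norm_nonneg _)] at this
    convert! this using 1
    field_simp
  have h3 := ((h2.sqrt hs.ne').fun_inv hr.ne').add_const α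
  have h4 := h3.fun_smul h
  have hc := c_pos hα (σ t)
  refine (h4.congr_of_eventuallyEq (Eventually.of_forall fun s => ?_)).congr_deriv ?_
  · simp [c]
  · rw [smul_sub, smul_smul, smul_smul, sub_eq_add_neg, ← neg_smul]
    have e1 : (√‖σ t‖)⁻¹ + α = c α (σ t) := by simp [c]
    rw [e1]
    congr 2
    rw [hsq]
    field_simp

end Gain

/-! ### Quadratic forms along curves and Dini derivatives -/

section Curves

open scoped RealInnerProductSpace

theorem abs_bilin_sub_le {S : Type*} [NormedAddCommGroup S] [NormedSpace ℝ S]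
    (b : S →L[ℝ] S →L[ℝ] ℝ) {x y : S} {R : ℝ} (hx : ‖x‖ ≤ R) (hy : ‖y‖ ≤ R) :
    |b x x - b y y| ≤ 2 * ‖b‖ * R * ‖x - y‖ := by
  have e : b x x - b y y = b (x - y) x + b y (x - y) := by
    simp only [map_sub, _root_.sub_apply]; ring
  have h1 := b.le_opNorm₂ (x - y) x
  have h2 := b.le_opNorm₂ y (x - y)
  rw [Real.norm_eq_abs] at h1 h2
  rw [e]
  have h3 : ‖b‖ * ‖x - y‖ * ‖x‖ ≤ ‖b‖ * ‖x - y‖ * R := by gcongr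
  have h4 : ‖b‖ * ‖y‖ * ‖x - y‖ ≤ ‖b‖ * R * ‖x - y‖ := by gcongr
  linarith [abs_add_le (b (x - y) x) (b y (x - y))]

theorem hasDerivAt_bilin_self {S : Type*} [NormedAddCommGroup S] [NormedSpace ℝ S]
    (b : S →L[ℝ] S →L[ℝ] ℝ) (hb : ∀ u v, b u v = b v u) {x : ℝ → S} {x' : S} {t : ℝ}
    (h : HasDerivAt x x' t) : HasDerivAt (fun s => b (x s) (x s)) (2 * b (x t) x') t := by
  have := (b.hasFDerivAt.comp_hasDerivAt t h).clm_apply h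
  refine this.congr_deriv ?_
  simp only [Function.comp_apply]
  rw [hb x' (x t)]; ring

/-- A quadratic form along a Lipschitz curve over a compact interval is Lipschitz. -/
theorem exists_lipschitz_bilin_self {S : Type*} [NormedAddCommGroup S] [NormedSpace ℝ S]
    (b : S →L[ℝ] S →L[ℝ] ℝ) {x : ℝ → S} {t₁ t₂ L : ℝ} (hL : 0 ≤ L)
    (h : ∀ s ∈ Icc t₁ t₂, ∀ t ∈ Icc t₁ t₂, ‖x t - x s‖ ≤ L * |t - s|) :
    ∃ K, 0 ≤ K ∧ ∀ s ∈ Icc t₁ t₂, ∀ t ∈ Icc t₁ t₂,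
      |b (x t) (x t) - b (x s) (x s)| ≤ K * |t - s| := by
  set R := ‖x t₁‖ + L * |t₂ - t₁| with hR
  refine ⟨2 * ‖b‖ * R * L, by positivity, fun s hs t ht => ?_⟩
  have hbd : ∀ u ∈ Icc t₁ t₂, ‖x u‖ ≤ R := by
    intro u hu
    have h1 := h t₁ ⟨le_rfl, hu.1.trans hu.2⟩ u hu
    have h2 : |u - t₁| ≤ |t₂ - t₁| := by
      rw [abs_of_nonneg (by linarith [hu.1]), abs_of_nonneg (by linarith [hu.1, hu.2])]
      linarith [hu.2]
    have h3 : L * |u - t₁| ≤ L * |t₂ - t₁| := by gcongr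
    have h4 := norm_le_norm_add_norm_sub (x t₁) (x u)
    rw [norm_sub_rev] at h4
    linarith
  refine (abs_bilin_sub_le b (hbd t ht) (hbd s hs)).trans ?_
  calc _ ≤ 2 * ‖b‖ * R * (L * |t - s|) := by gcongr; exact h s hs t ht
    _ = _ := by ring

theorem continuousOn_of_norm_sub_le {S : Type*} [NormedAddCommGroup S] {x : ℝ → S}
    {t₁ t₂ L : ℝ} (hL : 0 ≤ L)
    (h : ∀ s ∈ Icc t₁ t₂, ∀ t ∈ Icc t₁ t₂, ‖x t - x s‖ ≤ L * |t - s|) :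
    ContinuousOn x (Icc t₁ t₂) := by
  have : LipschitzOnWith ⟨L, hL⟩ x (Icc t₁ t₂) :=
    LipschitzOnWith.of_dist_le_mul fun s hs t ht => by
      rw [dist_eq_norm, Real.dist_eq]; exact h t ht s hs
  exact this.continuousOn

/-- If at time `t` every active branch of `max f₁ f₂` decreases at rate at least `D`, and `Φ`
accumulates `D`, then the upper right Dini derivative of `max f₁ f₂ + Φ` at `t` is nonpositive. -/
theorem eventually_max_add_sub_le {f₁ f₂ Φ : ℝ → ℝ} {t D : ℝ}
    (hf₁ : ContinuousAt f₁ t) (hf₂ : ContinuousAt f₂ t) (hΦ : HasDerivAt Φ D t)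
    (h₁ : f₂ t ≤ f₁ t → ∃ v, HasDerivAt f₁ v t ∧ v + D ≤ 0)
    (h₂ : f₁ t ≤ f₂ t → ∃ v, HasDerivAt f₂ v t ∧ v + D ≤ 0) {r : ℝ} (hr : 0 < r) :
    ∀ᶠ s in 𝓝[>] t, (max (f₁ s) (f₂ s) + Φ s) - (max (f₁ t) (f₂ t) + Φ t) ≤ r * (s - t) := by
  have key : ∀ f : ℝ → ℝ, (∃ v, HasDerivAt f v t ∧ v + D ≤ 0) →
      ∀ᶠ s in 𝓝[>] t, f s + Φ s - (f t + Φ t) ≤ r * (s - t) := by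
    rintro f ⟨v, hv, hvD⟩
    have h := (hv.add hΦ).hasDerivWithinAt (s := Ioi t)
    rw [hasDerivWithinAt_iff_tendsto_slope' (by simp)] at h
    filter_upwards [h.eventually_lt_const (hvD.trans_lt hr), self_mem_nhdsWithin] with s hs hts
    have hts' : 0 < s - t := sub_pos.2 hts
    rw [slope_def_field, div_lt_iff₀ hts'] at hs
    simpa using hs.le
  rcases lt_trichotomy (f₁ t) (f₂ t) with h | h | h
  · have hlt : ∀ᶠ s in 𝓝[>] t, f₁ s < f₂ s :=
      (hf₁.eventually_lt hf₂ h).filter_mono nhdsWithin_le_nhds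
    filter_upwards [key f₂ (h₂ h.le), hlt] with s hs hs'
    rwa [max_eq_right hs'.le, max_eq_right h.le]
  · filter_upwards [key f₁ (h₁ h.ge), key f₂ (h₂ h.le)] with s hs hs'
    rw [h, max_self]
    rcases max_cases (f₁ s) (f₂ s) with ⟨e, _⟩ | ⟨e, _⟩ <;> rw [e] <;> linarith
  · have hlt : ∀ᶠ s in 𝓝[>] t, f₂ s < f₁ s :=
      (hf₂.eventually_lt hf₁ h).filter_mono nhdsWithin_le_nhds
    filter_upwards [key f₁ (h₁ h.le), hlt] with s hs hs'
    rwa [max_eq_left hs'.le, max_eq_left h.le]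

end Curves

/-! ### The Lyapunov function -/

section Lyapunov

open scoped RealInnerProductSpace

variable {Z O : Type*} [NormedAddCommGroup Z] [NormedSpace ℝ Z] [NormedAddCommGroup O]
  [NormedSpace ℝ O] {n : ℕ}

/-- The vector `(c(σ) σ, z)`. -/
def chi (α : ℝ) (σ z : EuclideanSpace ℝ (Fin n)) :
    EuclideanSpace ℝ (Fin n) × EuclideanSpace ℝ (Fin n) := (c α σ • σ, z)

/-- Data of a closed loop `ζ' = a ζ + e σ`, `σ' = m ζ + d σ + k (c(σ) σ, z)`,
`z' = c(σ)² σ + g(t)` with `‖g‖ ≤ γ⁻¹` and output `h ζ`, together with two quadratic forms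
`bz`, `bx` which certify its stability. -/
structure Certificate (Z O : Type*) [NormedAddCommGroup Z] [NormedSpace ℝ Z]
    [NormedAddCommGroup O] [NormedSpace ℝ O] (n : ℕ) (γ α : ℝ) where
  a : Z →L[ℝ] Z
  e : EuclideanSpace ℝ (Fin n) →L[ℝ] Z
  m : Z →L[ℝ] EuclideanSpace ℝ (Fin n)
  d : EuclideanSpace ℝ (Fin n) →L[ℝ] EuclideanSpace ℝ (Fin n)
  k : EuclideanSpace ℝ (Fin n) × EuclideanSpace ℝ (Fin n) →L[ℝ] EuclideanSpace ℝ (Fin n)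
  h : Z →L[ℝ] O
  /-- The quadratic form of the linear subsystem. -/
  bz : Z →L[ℝ] Z →L[ℝ] ℝ
  /-- The quadratic form of the nonlinear subsystem, in the coordinates `(c(σ) σ, z)`. -/
  bx : EuclideanSpace ℝ (Fin n) × EuclideanSpace ℝ (Fin n) →L[ℝ]
    EuclideanSpace ℝ (Fin n) × EuclideanSpace ℝ (Fin n) →L[ℝ] ℝ
  /-- A decay rate. -/
  ω : ℝ
  /-- A coercivity constant. -/
  c₀ : ℝ
  α_pos : 0 < α
  γ_pos : 0 < γ
  ω_pos : 0 < ω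
  c₀_pos : 0 < c₀
  bz_symm : ∀ u v, bz u v = bz v u
  bx_symm : ∀ u v, bx u v = bx v u
  bz_coercive : ∀ u, c₀ * ‖u‖ ^ 2 ≤ bz u u
  bx_coercive : ∀ u, c₀ * ‖u‖ ^ 2 ≤ bx u u
  /-- Decay of `bz` where it dominates `bx`. -/
  linear_decay : ∀ ζ χ, bx χ χ ≤ bz ζ ζ →
    2 * bz ζ (a ζ + e (α⁻¹ • χ.1)) + ‖h ζ‖ ^ 2 + ω * bz ζ ζ ≤ 0
  /-- Decay of `bx` where it dominates `bz`, robustly in the perturbations `w₁, …, w₄`. -/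
  nonlinear_decay : ∀ ζ χ w₁ w₂ w₃ w₄, ‖w₁‖ ≤ ‖k χ‖ → ‖w₂‖ ≤ γ⁻¹ * ‖χ.1‖ →
    ‖w₃‖ ≤ α⁻¹ * ‖d χ.1‖ → ‖w₄‖ ≤ ‖m ζ‖ → bz ζ ζ ≤ bx χ χ →
    α * (2 * bx χ (k χ + (1 / 2 : ℝ) • w₁ + w₃ + w₄, χ.1 + w₂)) + ‖h ζ‖ ^ 2 + ω * bx χ χ ≤ 0

namespace Certificate

variable {γ α : ℝ} (P : Certificate Z O n γ α)

/-- The Lyapunov function: the larger of the two quadratic forms. -/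
def energy (ζ : Z) (σ z : EuclideanSpace ℝ (Fin n)) : ℝ :=
  max (P.bz ζ ζ) (P.bx (chi α σ z) (chi α σ z))

/-- The guaranteed rate of decrease of the Lyapunov function. -/
def rate (ζ : Z) (σ z : EuclideanSpace ℝ (Fin n)) : ℝ := ‖P.h ζ‖ ^ 2 + P.ω * P.energy ζ σ z

/-- `(ζ, σ, z)` is a Lipschitz curve on `[0, b]` which satisfies the differential equations of the
closed loop at almost every time; nothing is required of `z'` at times with `σ = 0`. -/
structure IsTrajectory (b : ℝ) (ζ : ℝ → Z) (σ z : ℝ → EuclideanSpace ℝ (Fin n)) : Prop where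
  lip_ζ : ∃ L, 0 ≤ L ∧ ∀ s ∈ Icc 0 b, ∀ t ∈ Icc 0 b, ‖ζ t - ζ s‖ ≤ L * |t - s|
  lip_σ : ∃ L, 0 ≤ L ∧ ∀ s ∈ Icc 0 b, ∀ t ∈ Icc 0 b, ‖σ t - σ s‖ ≤ L * |t - s|
  lip_z : ∃ L, 0 ≤ L ∧ ∀ s ∈ Icc 0 b, ∀ t ∈ Icc 0 b, ‖z t - z s‖ ≤ L * |t - s|
  deriv : ∀ᵐ t, t ∈ Ioo 0 b → HasDerivAt ζ (P.a (ζ t) + P.e (σ t)) t ∧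
    HasDerivAt σ (P.m (ζ t) + P.d (σ t) + P.k (chi α (σ t) (z t))) t ∧
    (σ t ≠ 0 → ∃ g, ‖g‖ ≤ γ⁻¹ ∧ HasDerivAt z (c α (σ t) ^ 2 • σ t + g) t)

theorem energy_zero : P.energy 0 0 0 = 0 := by
  have : chi α (0 : EuclideanSpace ℝ (Fin n)) 0 = 0 := by simp [chi]
  rw [energy, this, map_zero, map_zero]
  simp

theorem rate_nonneg (ζ : Z) (σ z : EuclideanSpace ℝ (Fin n)) : 0 ≤ P.rate ζ σ z := by
  have h1 : 0 ≤ P.energy ζ σ z :=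
    (mul_nonneg P.c₀_pos.le (sq_nonneg _)).trans ((P.bz_coercive ζ).trans (le_max_left _ _))
  have := mul_nonneg P.ω_pos.le h1
  unfold rate; positivity

variable {P}

/-- Decay of the first quadratic form along a trajectory, at a time where it is the larger one. -/
theorem exists_hasDerivAt_bz {ζ : ℝ → Z} {σ z : EuclideanSpace ℝ (Fin n)} {t : ℝ}
    (hζ : HasDerivAt ζ (P.a (ζ t) + P.e σ) t)
    (hle : P.bx (chi α σ z) (chi α σ z) ≤ P.bz (ζ t) (ζ t)) :
    ∃ v, HasDerivAt (fun s => P.bz (ζ s) (ζ s)) v t ∧ v + P.rate (ζ t) σ z ≤ 0 := by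
  refine ⟨_, hasDerivAt_bilin_self P.bz P.bz_symm hζ, ?_⟩
  have hc := c_pos P.α_pos σ
  have hα := P.α_pos
  -- `σ = α⁻¹ (χ̃)₁` for `χ̃ = (α / c(σ)) χ`, where `α ≤ c(σ)`
  have hl : α / c α σ ≤ 1 := (div_le_one hc).2 (le_c α σ)
  have hl0 : 0 ≤ α / c α σ := by positivity
  have hχ : 0 ≤ P.bx (chi α σ z) (chi α σ z) :=
    (mul_nonneg P.c₀_pos.le (sq_nonneg _)).trans (P.bx_coercive _)
  have h1 := P.linear_decay (ζ t) ((α / c α σ) • chi α σ z) (by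
    simp only [map_smul, _root_.smul_apply, smul_eq_mul]
    refine le_trans ?_ hle
    have : α / c α σ * (α / c α σ) ≤ 1 := mul_le_one₀ hl hl0 hl
    rw [← mul_assoc]
    exact mul_le_of_le_one_left hχ this)
  have h2 : α⁻¹ • ((α / c α σ) • chi α σ z).1 = σ := by
    simp only [chi, Prod.smul_mk, smul_smul]
    rw [show α⁻¹ * (α / c α σ * c α σ) = 1 by field_simp, one_smul]
  rw [h2] at h1
  rw [rate, energy, max_eq_left hle]
  linarith

/-- Decay of the second quadratic form along a trajectory, at a time with `σ ≠ 0` where it is the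
larger one. The derivative of `χ = (c(σ) σ, z)` is the perturbed linear field times `c(σ) ≥ α`. -/
theorem exists_hasDerivAt_bx {ζ : Z} {σ z : ℝ → EuclideanSpace ℝ (Fin n)} {t : ℝ}
    {g : EuclideanSpace ℝ (Fin n)} (hσ0 : σ t ≠ 0) (hg : ‖g‖ ≤ γ⁻¹)
    (hσ : HasDerivAt σ (P.m ζ + P.d (σ t) + P.k (chi α (σ t) (z t))) t)
    (hz : HasDerivAt z (c α (σ t) ^ 2 • σ t + g) t)
    (hle : P.bz ζ ζ ≤ P.bx (chi α (σ t) (z t)) (chi α (σ t) (z t))) :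
    ∃ v, HasDerivAt (fun s => P.bx (chi α (σ s) (z s)) (chi α (σ s) (z s))) v t ∧
      v + P.rate ζ (σ t) (z t) ≤ 0 := by
  have hα := P.α_pos
  have hc := c_pos hα (σ t)
  have hs : 0 < ‖σ t‖ := norm_pos_iff.2 hσ0
  have hr : 0 < √‖σ t‖ := Real.sqrt_pos.2 hs
  have hder := hasDerivAt_bilin_self P.bx P.bx_symm
    ((hasDerivAt_c_smul hα hσ hσ0).prodMk hz)
  refine ⟨_, hder, ?_⟩
  set x := σ t with hx
  set χ := chi α x (z t) with hχ
  set l := 1 / √‖x‖ / c α x with hl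
  have hl0 : 0 ≤ l := by positivity
  have hl1 : l ≤ 1 := by
    rw [hl, div_le_one hc, c]; linarith
  -- the derivative of `χ` is `c(σ)` times the perturbed linear field
  set w₁ := -(l • (⟪x, P.k χ⟫ / ‖x‖ ^ 2) • x) with hw₁
  set w₂ := (c α x)⁻¹ • g with hw₂
  set w₃ := P.d x - (l / 2) • (⟪x, P.d x⟫ / ‖x‖ ^ 2) • x with hw₃
  set w₄ := P.m ζ - (l / 2) • (⟪x, P.m ζ⟫ / ‖x‖ ^ 2) • x with hw₄
  have hχ1 : χ.1 = c α x • x := rfl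
  have e : ((c α x • (P.m ζ + P.d x + P.k χ - (l / 2) •
      (⟪x, P.m ζ + P.d x + P.k χ⟫ / ‖x‖ ^ 2) • x), c α x ^ 2 • x + g) :
        EuclideanSpace ℝ (Fin n) × EuclideanSpace ℝ (Fin n))
      = c α x • (P.k χ + (1 / 2 : ℝ) • w₁ + w₃ + w₄, χ.1 + w₂) := by
    rw [Prod.smul_mk, hχ1, hw₂]
    congr 1
    · congr 1
      rw [hw₁, hw₃, hw₄, inner_add_right, inner_add_right]
      module
    · rw [smul_add, smul_smul, smul_smul, mul_inv_cancel₀ hc.ne', one_smul, pow_two]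
  have hd := P.nonlinear_decay ζ χ w₁ w₂ w₃ w₄ (norm_proj_le x _ hl0 hl1) ?_ ?_
    (norm_sub_proj_le x _ hl0 hl1) hle
  · have hbx : 0 ≤ P.bx χ χ := (mul_nonneg P.c₀_pos.le (sq_nonneg _)).trans (P.bx_coercive _)
    change 2 * P.bx χ (_, _) + _ ≤ 0
    rw [e, map_smul, smul_eq_mul, rate, energy, max_eq_right hle]
    set y := 2 * P.bx χ (P.k χ + (1 / 2 : ℝ) • w₁ + w₃ + w₄, χ.1 + w₂) with hy
    have hpos : 0 ≤ ‖P.h ζ‖ ^ 2 + P.ω * P.bx χ χ := by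
      have := mul_nonneg P.ω_pos.le hbx
      positivity
    have hy0 : y ≤ 0 := by
      by_contra hcon
      have := mul_pos hα (not_le.1 hcon)
      linarith
    have h3 : c α x * y ≤ α * y := mul_le_mul_of_nonpos_right (le_c α x) hy0
    have h4 : 2 * (c α x * P.bx χ (P.k χ + (1 / 2 : ℝ) • w₁ + w₃ + w₄, χ.1 + w₂))
        = c α x * y := by rw [hy]; ring
    rw [h4]
    linarith
  · -- `c(σ)⁻¹ ≤ ‖c(σ) σ‖` because `c(σ)² ‖σ‖ = (1 + α √‖σ‖)² ≥ 1`
    rw [hw₂, hχ1, norm_smul, norm_inv, Real.norm_of_nonneg hc.le]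
    have h5 : 1 ≤ c α x * ‖c α x • x‖ := by
      have := norm_c_sq_smul hα hσ0
      rw [pow_two, mul_smul, norm_smul, Real.norm_of_nonneg hc.le] at this
      rw [this]
      exact one_le_pow₀ (by linarith [mul_nonneg hα.le hr.le])
    have h6 : (c α x)⁻¹ ≤ ‖c α x • x‖ := by
      rw [inv_le_iff_one_le_mul₀ hc, mul_comm]; exact h5
    rw [mul_comm]
    exact mul_le_mul hg h6 (by positivity) ((norm_nonneg g).trans hg)
  · refine (norm_sub_proj_le x _ hl0 hl1).trans ?_
    rw [hχ1, map_smul, norm_smul, Real.norm_of_nonneg hc.le, ← mul_assoc]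
    have : 1 ≤ α⁻¹ * c α x := by
      rw [inv_mul_eq_div, one_le_div hα]; exact le_c α x
    exact le_mul_of_one_le_left (norm_nonneg _) this

/-- At an equilibrium of `σ' = m ζ + k (0, z)`, the nonlinear form can dominate only at the
origin. -/
theorem eq_zero_of_sliding {ζ : Z} {z : EuclideanSpace ℝ (Fin n)}
    (h0 : P.m ζ + P.k (0, z) = 0) (hle : P.bz ζ ζ ≤ P.bx (0, z) (0, z)) : ζ = 0 ∧ z = 0 := by
  have h1 := P.nonlinear_decay ζ (0, z) 0 0 0 (P.m ζ) (by simp) (by simp) (by simp) le_rfl hle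
  have e : ((P.k (0, z) + (1 / 2 : ℝ) • (0 : EuclideanSpace ℝ (Fin n)) + 0 + P.m ζ,
      (0 : EuclideanSpace ℝ (Fin n)) + 0) :
      EuclideanSpace ℝ (Fin n) × EuclideanSpace ℝ (Fin n)) = 0 := by
    simp [add_comm, h0]
  simp only at h1
  rw [e, map_zero] at h1
  have h2 := P.bx_coercive (0, z)
  have h3 := P.bz_coercive ζ
  have h4 : 0 ≤ P.c₀ * ‖ζ‖ ^ 2 := mul_nonneg P.c₀_pos.le (sq_nonneg _)
  have h5 : P.bx (0, z) (0, z) ≤ 0 := by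
    by_contra hcon
    have := mul_pos P.ω_pos (not_le.1 hcon)
    nlinarith [sq_nonneg ‖P.h ζ‖]
  have aux : ∀ y : ℝ, P.c₀ * y ^ 2 ≤ 0 → y = 0 := fun y hy => by
    have := P.c₀_pos
    have h6 : y ^ 2 ≤ 0 := by
      by_contra hcon
      have := mul_pos this (not_le.1 hcon)
      linarith
    exact pow_eq_zero_iff (two_ne_zero) |>.1 (le_antisymm h6 (sq_nonneg y))
  have h7 := norm_eq_zero.1 (aux _ (h2.trans h5))
  exact ⟨norm_eq_zero.1 (aux _ (h3.trans (hle.trans h5))), (Prod.mk.inj h7).2⟩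

end Certificate

end Lyapunov

/-! ### Decrease of the Lyapunov function along trajectories -/

section Decrease

open scoped RealInnerProductSpace

variable {Z O : Type*} [NormedAddCommGroup Z] [NormedSpace ℝ Z] [NormedAddCommGroup O]
  [NormedSpace ℝ O] {n : ℕ}

namespace Certificate

variable {γ α : ℝ} {P : Certificate Z O n γ α} {b : ℝ} {ζ : ℝ → Z}
  {σ z : ℝ → EuclideanSpace ℝ (Fin n)} {Φ : ℝ → ℝ}

theorem IsTrajectory.continuousOn_ζ (h : P.IsTrajectory b ζ σ z) : ContinuousOn ζ (Icc 0 b) :=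
  let ⟨_, hL, hl⟩ := h.lip_ζ
  continuousOn_of_norm_sub_le hL hl

theorem IsTrajectory.continuousOn_σ (h : P.IsTrajectory b ζ σ z) : ContinuousOn σ (Icc 0 b) :=
  let ⟨_, hL, hl⟩ := h.lip_σ
  continuousOn_of_norm_sub_le hL hl

theorem IsTrajectory.continuousOn_z (h : P.IsTrajectory b ζ σ z) : ContinuousOn z (Icc 0 b) :=
  let ⟨_, hL, hl⟩ := h.lip_z
  continuousOn_of_norm_sub_le hL hl

theorem IsTrajectory.continuousOn_bz (h : P.IsTrajectory b ζ σ z) :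
    ContinuousOn (fun t => P.bz (ζ t) (ζ t)) (Icc 0 b) :=
  (P.bz.continuous.comp_continuousOn h.continuousOn_ζ).clm_apply h.continuousOn_ζ

theorem IsTrajectory.continuousOn_bx (h : P.IsTrajectory b ζ σ z) :
    ContinuousOn (fun t => P.bx (chi α (σ t) (z t)) (chi α (σ t) (z t))) (Icc 0 b) := by
  have : ContinuousOn (fun t => chi α (σ t) (z t)) (Icc 0 b) :=
    ((continuous_c_smul P.α_pos).comp_continuousOn h.continuousOn_σ).prodMk h.continuousOn_z
  exact (P.bx.continuous.comp_continuousOn this).clm_apply this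

theorem IsTrajectory.continuousOn_energy (h : P.IsTrajectory b ζ σ z) :
    ContinuousOn (fun t => P.energy (ζ t) (σ t) (z t)) (Icc 0 b) :=
  h.continuousOn_bz.sup h.continuousOn_bx

theorem IsTrajectory.continuousOn_rate (h : P.IsTrajectory b ζ σ z) :
    ContinuousOn (fun t => P.rate (ζ t) (σ t) (z t)) (Icc 0 b) :=
  ((P.h.continuous.comp_continuousOn h.continuousOn_ζ).norm.pow 2).add
    (h.continuousOn_energy.const_smul P.ω)

/-- Where `σ` does not vanish, the Lyapunov function is Lipschitz and decreases. -/
theorem IsTrajectory.energy_add_le_of_ne_zero (h : P.IsTrajectory b ζ σ z)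
    (hΦL : ∃ L, 0 ≤ L ∧ ∀ s ∈ Icc 0 b, ∀ t ∈ Icc 0 b, ‖Φ t - Φ s‖ ≤ L * |t - s|)
    (hΦ : ∀ t ∈ Ioo 0 b, HasDerivAt Φ (P.rate (ζ t) (σ t) (z t)) t)
    {t₁ t₂ : ℝ} (h0 : 0 ≤ t₁) (h12 : t₁ ≤ t₂) (hb : t₂ ≤ b) (hσ : ∀ t ∈ Icc t₁ t₂, σ t ≠ 0) :
    P.energy (ζ t₂) (σ t₂) (z t₂) + Φ t₂ ≤ P.energy (ζ t₁) (σ t₁) (z t₁) + Φ t₁ := by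
  have hsub : Icc t₁ t₂ ⊆ Icc 0 b := Icc_subset_Icc h0 hb
  have hsub' : Ioo t₁ t₂ ⊆ Ioo 0 b := Ioo_subset_Ioo h0 hb
  obtain ⟨L₁, hL₁, hl₁⟩ := h.lip_ζ
  obtain ⟨L₂, hL₂, hl₂⟩ := h.lip_σ
  obtain ⟨L₃, hL₃, hl₃⟩ := h.lip_z
  obtain ⟨L₄, hL₄, hl₄⟩ := hΦL
  have hΦc : ContinuousOn Φ (Icc 0 b) := continuousOn_of_norm_sub_le hL₄ hl₄
  obtain ⟨t₀, ht₀, hmin⟩ := isCompact_Icc.exists_isMinOn (nonempty_Icc.2 h12)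
    (h.continuousOn_σ.mono hsub).norm
  have hm : 0 < ‖σ t₀‖ := norm_pos_iff.2 (hσ t₀ ht₀)
  have hlχ : ∀ s ∈ Icc t₁ t₂, ∀ t ∈ Icc t₁ t₂, ‖chi α (σ t) (z t) - chi α (σ s) (z s)‖ ≤
      ((2 / √‖σ t₀‖ + α) * L₂ + L₃) * |t - s| := by
    intro s hs t ht
    have hα := P.α_pos
    have e1 : ‖c α (σ t) • σ t - c α (σ s) • σ s‖ ≤ (2 / √‖σ t₀‖ + α) * (L₂ * |t - s|) := by
      refine (norm_c_smul_sub_le hα hm (hmin ht) (hmin hs)).trans ?_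
      gcongr
      exact hl₂ s (hsub hs) t (hsub ht)
    have e2 := hl₃ s (hsub hs) t (hsub ht)
    have e3 : 0 ≤ (2 / √‖σ t₀‖ + α) * (L₂ * |t - s|) := by positivity
    have e4 : 0 ≤ L₃ * |t - s| := by positivity
    rw [chi, chi, Prod.mk_sub_mk, Prod.norm_mk, max_le_iff]
    constructor <;> linarith
  have hLχ : 0 ≤ (2 / √‖σ t₀‖ + α) * L₂ + L₃ := by have := P.α_pos; positivity
  obtain ⟨K₁, hK₁, hk₁⟩ := exists_lipschitz_bilin_self P.bz hL₁
    (fun s hs t ht => hl₁ s (hsub hs) t (hsub ht))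
  obtain ⟨K₂, hK₂, hk₂⟩ := exists_lipschitz_bilin_self P.bx hLχ hlχ
  have hN : volume {t | ¬ (t ∈ Ioo 0 b → HasDerivAt ζ (P.a (ζ t) + P.e (σ t)) t ∧
    HasDerivAt σ (P.m (ζ t) + P.d (σ t) + P.k (chi α (σ t) (z t))) t ∧
    (σ t ≠ 0 → ∃ g, ‖g‖ ≤ γ⁻¹ ∧ HasDerivAt z (c α (σ t) ^ 2 • σ t + g) t))} = 0 := h.deriv
  refine le_of_ae_eventually_sub_le (C := K₁ + K₂ + L₄) h12
    ((h.continuousOn_energy.add hΦc).mono hsub) hN ?_ ?_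
  · intro t ht
    filter_upwards [Ioo_mem_nhdsGT ht.2] with s hs
    have hs' : s ∈ Icc t₁ t₂ := ⟨ht.1.le.trans hs.1.le, hs.2.le⟩
    have ht' : t ∈ Icc t₁ t₂ := Ioo_subset_Icc_self ht
    have e1 := hk₁ t ht' s hs'
    have e2 := hk₂ t ht' s hs'
    have e3 := (le_abs_self _).trans (hl₄ t (hsub ht') s (hsub hs'))
    have e4 := (le_abs_self _).trans (abs_max_sub_max_le_max (P.bz (ζ s) (ζ s))
      (P.bx (chi α (σ s) (z s)) (chi α (σ s) (z s))) (P.bz (ζ t) (ζ t))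
      (P.bx (chi α (σ t) (z t)) (chi α (σ t) (z t))))
    have hpos : 0 < s - t := sub_pos.2 hs.1
    rw [abs_of_pos hpos] at e1 e2 e3
    have e5 := e4.trans (max_le_add_of_nonneg (abs_nonneg _) (abs_nonneg _))
    change max _ _ + Φ s - (max _ _ + Φ t) ≤ _
    linarith
  · intro t ht htN r hr
    have htb := hsub' ht
    have hnhds : Icc 0 b ∈ 𝓝 t := Icc_mem_nhds htb.1 htb.2
    obtain ⟨d1, d2, d3⟩ := not_not.1 htN htb
    have hσt := hσ t (Ioo_subset_Icc_self ht)
    obtain ⟨g, hg, d3⟩ := d3 hσt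
    exact eventually_max_add_sub_le (h.continuousOn_bz.continuousAt hnhds)
      (h.continuousOn_bx.continuousAt hnhds) (hΦ t htb) (exists_hasDerivAt_bz d1)
      (exists_hasDerivAt_bx hσt hg d2 d3) hr

theorem IsTrajectory.energy_add_le_of_ne_zero_Ioc (h : P.IsTrajectory b ζ σ z)
    (hΦL : ∃ L, 0 ≤ L ∧ ∀ s ∈ Icc 0 b, ∀ t ∈ Icc 0 b, ‖Φ t - Φ s‖ ≤ L * |t - s|)
    (hΦ : ∀ t ∈ Ioo 0 b, HasDerivAt Φ (P.rate (ζ t) (σ t) (z t)) t)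
    {t₁ t₂ : ℝ} (h0 : 0 ≤ t₁) (h12 : t₁ ≤ t₂) (hb : t₂ ≤ b) (hσ : ∀ t ∈ Ioc t₁ t₂, σ t ≠ 0) :
    P.energy (ζ t₂) (σ t₂) (z t₂) + Φ t₂ ≤ P.energy (ζ t₁) (σ t₁) (z t₁) + Φ t₁ := by
  rcases h12.eq_or_lt with rfl | hlt
  · rfl
  have hΦc : ContinuousOn Φ (Icc 0 b) :=
    let ⟨_, hL, hl⟩ := hΦL
    continuousOn_of_norm_sub_le hL hl
  have hcont := ((h.continuousOn_energy.add hΦc) t₁ ⟨h0, h12.trans hb⟩).mono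
    (Ioo_subset_Icc_self.trans (Icc_subset_Icc h0 hb))
  rw [ContinuousWithinAt, nhdsWithin_Ioo_eq_nhdsGT hlt] at hcont
  refine ge_of_tendsto hcont ?_
  filter_upwards [Ioo_mem_nhdsGT hlt] with t ht
  exact h.energy_add_le_of_ne_zero hΦL hΦ (h0.trans ht.1.le) ht.2.le hb
    fun s hs => hσ s ⟨ht.1.trans_le hs.1, hs.2⟩

/-- The Lyapunov function `V` is not Lipschitz near `σ = 0`. There, `V(s)` is compared with the
value at the last zero `s'` of `σ` before `s`: `V(s) ≤ V(s')` by decrease off the zero set, and on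
the zero set `V` is a Lipschitz function of the state. -/
theorem IsTrajectory.energy_add_le (h : P.IsTrajectory b ζ σ z)
    (hΦL : ∃ L, 0 ≤ L ∧ ∀ s ∈ Icc 0 b, ∀ t ∈ Icc 0 b, ‖Φ t - Φ s‖ ≤ L * |t - s|)
    (hΦ : ∀ t ∈ Ioo 0 b, HasDerivAt Φ (P.rate (ζ t) (σ t) (z t)) t)
    {t₁ t₂ : ℝ} (h0 : 0 ≤ t₁) (h12 : t₁ ≤ t₂) (hb : t₂ ≤ b) :
    P.energy (ζ t₂) (σ t₂) (z t₂) + Φ t₂ ≤ P.energy (ζ t₁) (σ t₁) (z t₁) + Φ t₁ := by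
  set W : ℝ → ℝ := fun t => P.energy (ζ t) (σ t) (z t) + Φ t with hW
  have hsub' : Ioo t₁ t₂ ⊆ Ioo 0 b := Ioo_subset_Ioo h0 hb
  have hoff : ∀ s t, 0 ≤ s → s ≤ t → t ≤ b → (∀ u ∈ Ioc s t, σ u ≠ 0) → W t ≤ W s :=
    fun s t hs hst ht hu => h.energy_add_le_of_ne_zero_Ioc hΦL hΦ hs hst ht hu
  obtain ⟨L₁, hL₁, hl₁⟩ := h.lip_ζ
  obtain ⟨L₃, hL₃, hl₃⟩ := h.lip_z
  have hcσ := h.continuousOn_σ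
  obtain ⟨L₄, hL₄, hl₄⟩ := hΦL
  have hΦc : ContinuousOn Φ (Icc 0 b) := continuousOn_of_norm_sub_le hL₄ hl₄
  -- the last zero of `σ` before `s`
  have hlast : ∀ t ∈ Icc 0 b, σ t = 0 → ∀ s ∈ Icc 0 b, t ≤ s →
      ∃ u ∈ Icc t s, σ u = 0 ∧ W s ≤ W u := by
    intro t ht ht0 s hs hts
    have hsub : Icc t s ⊆ Icc 0 b := Icc_subset_Icc ht.1 hs.2
    have hcl : IsClosed (Icc t s ∩ σ ⁻¹' {0}) :=
      (hcσ.mono hsub).preimage_isClosed_of_isClosed isClosed_Icc isClosed_singleton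
    have hcomp : IsCompact (Icc t s ∩ σ ⁻¹' {0}) :=
      isCompact_Icc.of_isClosed_subset hcl inter_subset_left
    obtain ⟨u, hu, hmax⟩ := hcomp.exists_isGreatest ⟨t, ⟨le_rfl, hts⟩, ht0⟩
    refine ⟨u, hu.1, hu.2, hoff u s (ht.1.trans hu.1.1) hu.1.2 hs.2 fun v hv hv0 => ?_⟩
    exact absurd (hmax ⟨⟨hu.1.1.trans hv.1.le, hv.2⟩, hv0⟩) (not_le.2 hv.1)
  obtain ⟨K₁, hK₁, hk₁⟩ := exists_lipschitz_bilin_self P.bz hL₁ hl₁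
  obtain ⟨K₂, hK₂, hk₂⟩ := exists_lipschitz_bilin_self P.bx (x := fun t => ((0 :
    EuclideanSpace ℝ (Fin n)), z t)) hL₃ (fun s hs t ht => by
      rw [Prod.mk_sub_mk, sub_zero, Prod.norm_mk, norm_zero, max_eq_right (norm_nonneg _)]
      exact hl₃ s hs t ht)
  have hχ0 : ∀ t, σ t = 0 → chi α (σ t) (z t) = (0, z t) := fun t ht => by simp [chi, ht]
  have hN : volume {t | ¬ (t ∈ Ioo 0 b → HasDerivAt ζ (P.a (ζ t) + P.e (σ t)) t ∧
    HasDerivAt σ (P.m (ζ t) + P.d (σ t) + P.k (chi α (σ t) (z t))) t ∧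
    (σ t ≠ 0 → ∃ g, ‖g‖ ≤ γ⁻¹ ∧ HasDerivAt z (c α (σ t) ^ 2 • σ t + g) t))} = 0 := h.deriv
  -- right neighbourhoods free of zeros
  have hfree : ∀ t ∈ Ioo 0 b, (∀ᶠ s in 𝓝[>] t, σ s ≠ 0) → ∀ᶠ s in 𝓝[>] t, W s ≤ W t := by
    intro t ht hne
    obtain ⟨u, hu, hu'⟩ := (mem_nhdsGT_iff_exists_Ioo_subset).1 hne
    filter_upwards [Ioo_mem_nhdsGT (lt_min hu ht.2)] with s hs
    refine hoff t s ht.1.le hs.1.le (hs.2.le.trans (min_le_right _ _)) fun v hv => ?_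
    exact hu' ⟨hv.1, hv.2.trans_lt (hs.2.trans_le (min_le_left _ _))⟩
  have hne_of : ∀ t ∈ Ioo 0 b, σ t ≠ 0 → ∀ᶠ s in 𝓝[>] t, σ s ≠ 0 := fun t ht hσt =>
    ((hcσ.continuousAt (Icc_mem_nhds ht.1 ht.2)).eventually_ne hσt).filter_mono
      nhdsWithin_le_nhds
  refine le_of_ae_eventually_sub_le (φ := W) (C := K₁ + K₂ + L₄) h12
    ((h.continuousOn_energy.add hΦc).mono (Icc_subset_Icc h0 hb)) hN ?_ ?_
  · intro t ht
    have htb := hsub' ht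
    have ht' : t ∈ Icc 0 b := Ioo_subset_Icc_self htb
    by_cases hσt : σ t = 0
    · filter_upwards [Ioo_mem_nhdsGT htb.2] with s hs
      obtain ⟨u, hu, hu0, hWu⟩ := hlast t ht' hσt s ⟨ht'.1.trans hs.1.le, hs.2.le⟩ hs.1.le
      have hu' : u ∈ Icc 0 b := ⟨ht'.1.trans hu.1, hu.2.trans hs.2.le⟩
      have e1 := hk₁ t ht' u hu'
      have e2 := hk₂ t ht' u hu'
      have e3 := (le_abs_self _).trans (hl₄ t ht' u hu')
      have e4 := (le_abs_self _).trans (abs_max_sub_max_le_max (P.bz (ζ u) (ζ u))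
        (P.bx (chi α (σ u) (z u)) (chi α (σ u) (z u))) (P.bz (ζ t) (ζ t))
        (P.bx (chi α (σ t) (z t)) (chi α (σ t) (z t))))
      have e5 := e4.trans (max_le_add_of_nonneg (abs_nonneg _) (abs_nonneg _))
      rw [abs_of_nonneg (sub_nonneg.2 hu.1)] at e1 e2 e3
      have e6 : W u - W t ≤ (K₁ + K₂ + L₄) * (u - t) := by
        change max _ _ + Φ u - (max _ _ + Φ t) ≤ _
        rw [hχ0 u hu0, hχ0 t hσt] at *
        linarith
      have e7 : (K₁ + K₂ + L₄) * (u - t) ≤ (K₁ + K₂ + L₄) * (s - t) := by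
        gcongr; exact hu.2
      linarith
    · filter_upwards [hfree t htb (hne_of t htb hσt), self_mem_nhdsWithin] with s hs hts
      have : 0 < s - t := sub_pos.2 hts
      have : 0 ≤ (K₁ + K₂ + L₄) * (s - t) := by positivity
      linarith
  · intro t ht htN r hr
    have htb := hsub' ht
    have ht' : t ∈ Icc 0 b := Ioo_subset_Icc_self htb
    have hnhds : Icc 0 b ∈ 𝓝 t := Icc_mem_nhds htb.1 htb.2
    obtain ⟨d1, d2, -⟩ := not_not.1 htN htb
    have hfree' : (∀ᶠ s in 𝓝[>] t, σ s ≠ 0) → ∀ᶠ s in 𝓝[>] t, W s - W t ≤ r * (s - t) := by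
      intro hne
      filter_upwards [hfree t htb hne, self_mem_nhdsWithin] with s hs hts
      have := mul_pos hr (sub_pos.2 hts)
      linarith
    by_cases hσt : σ t = 0
    swap
    · exact hfree' (hne_of t htb hσt)
    by_cases hv : P.m (ζ t) + P.k (0, z t) = 0
    swap
    · -- `σ` crosses zero with nonzero velocity, so the zero is isolated
      have d2' : HasDerivAt σ (P.m (ζ t) + P.k (0, z t)) t := by
        refine d2.congr_deriv ?_
        rw [hχ0 t hσt, hσt, map_zero, add_zero]
      have := d2'.eventually_ne (c := 0) hv
      exact hfree' (this.filter_mono (nhdsWithin_mono _ fun s hs => ne_of_gt hs))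
    by_cases hle : P.bz (ζ t) (ζ t) ≤ P.bx (0, z t) (0, z t)
    swap
    · refine eventually_max_add_sub_le (h.continuousOn_bz.continuousAt hnhds)
        (h.continuousOn_bx.continuousAt hnhds) (hΦ t htb) (exists_hasDerivAt_bz d1)
        (fun hcon => absurd ?_ hle) hr
      rwa [hχ0 t hσt] at hcon
    · -- the trajectory is at the origin, where `V` is quadratically small on the zero set of `σ`
      obtain ⟨hζt, hzt⟩ := eq_zero_of_sliding hv hle
      have hVt : P.energy (ζ t) (σ t) (z t) = 0 := by
        rw [hζt, hσt, hzt, energy_zero]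
      have hΦt : HasDerivAt Φ 0 t := by
        refine (hΦ t htb).congr_deriv ?_
        rw [rate, hVt, hζt]; simp
      set K := ‖P.bz‖ * L₁ ^ 2 + ‖P.bx‖ * L₃ ^ 2 with hK
      have hK0 : 0 ≤ K := by positivity
      have e0 : ∀ᶠ s in 𝓝[>] t, K * (s - t) < r / 2 := by
        have : Tendsto (fun s : ℝ => K * (s - t)) (𝓝 t) (𝓝 (K * (t - t))) :=
          Continuous.tendsto (by fun_prop) t
        rw [sub_self, mul_zero] at this
        exact (this.eventually_lt_const (half_pos hr)).filter_mono nhdsWithin_le_nhds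
      have e1 : ∀ᶠ s in 𝓝 t, |Φ s - Φ t| ≤ r / 2 * |s - t| := by
        have := (hasDerivAt_iff_isLittleO.1 hΦt).def (half_pos hr)
        simpa using this
      obtain ⟨δ, hδ, hball⟩ := Metric.eventually_nhds_iff.1 e1
      have e2 : ∀ᶠ s in 𝓝[>] t, s < t + δ :=
        mem_nhdsWithin_of_mem_nhds (Iio_mem_nhds (by linarith))
      filter_upwards [Ioo_mem_nhdsGT htb.2, e0, e2] with s hs hs0 hsδ
      obtain ⟨u, hu, hu0, hWu⟩ := hlast t ht' hσt s ⟨ht'.1.trans hs.1.le, hs.2.le⟩ hs.1.le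
      have hu' : u ∈ Icc 0 b := ⟨ht'.1.trans hu.1, hu.2.trans hs.2.le⟩
      have hut : 0 ≤ u - t := sub_nonneg.2 hu.1
      have hus : u - t ≤ s - t := by linarith [hu.2]
      have f1 : P.bz (ζ u) (ζ u) ≤ ‖P.bz‖ * L₁ ^ 2 * (u - t) ^ 2 := by
        have g1 := hl₁ t ht' u hu'
        rw [hζt, sub_zero, abs_of_nonneg hut] at g1
        have g2 := (le_abs_self _).trans (P.bz.le_opNorm₂ (ζ u) (ζ u))
        calc _ ≤ _ := g2
          _ ≤ ‖P.bz‖ * (L₁ * (u - t)) * (L₁ * (u - t)) := by gcongr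
          _ = _ := by ring
      have f2 : P.bx (0, z u) (0, z u) ≤ ‖P.bx‖ * L₃ ^ 2 * (u - t) ^ 2 := by
        have g1 := hl₃ t ht' u hu'
        rw [hzt, sub_zero, abs_of_nonneg hut] at g1
        have g2 := (le_abs_self _).trans (P.bx.le_opNorm₂ (0, z u) (0, z u))
        rw [Prod.norm_mk, norm_zero, max_eq_right (norm_nonneg _)] at g2
        calc _ ≤ _ := g2
          _ ≤ ‖P.bx‖ * (L₃ * (u - t)) * (L₃ * (u - t)) := by gcongr
          _ = _ := by ring
      have f3 : Φ u - Φ t ≤ r / 2 * (u - t) := by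
        have := hball (y := u) (by rw [Real.dist_eq, abs_of_nonneg hut]; linarith)
        rw [abs_of_nonneg hut] at this
        exact (le_abs_self _).trans this
      have f4 : P.energy (ζ u) (σ u) (z u) ≤ K * (u - t) ^ 2 := by
        rw [energy, hχ0 u hu0]
        have g1 : 0 ≤ ‖P.bz‖ * L₁ ^ 2 * (u - t) ^ 2 := by positivity
        have g2 : 0 ≤ ‖P.bx‖ * L₃ ^ 2 * (u - t) ^ 2 := by positivity
        apply max_le <;> rw [hK, add_mul] <;> linarith
      have f5 : K * (u - t) ^ 2 ≤ r / 2 * (u - t) := by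
        rw [pow_two, ← mul_assoc]
        gcongr
        exact (mul_le_mul_of_nonneg_left hus hK0).trans hs0.le
      have f6 : W u - W t ≤ r * (u - t) := by
        change P.energy _ _ _ + Φ u - (P.energy _ _ _ + Φ t) ≤ _
        rw [hVt]
        linarith
      have f7 : r * (u - t) ≤ r * (s - t) := by gcongr
      linarith

end Certificate

end Decrease

/-! ### Consequences: boundedness, convergence and cost -/

section Consequences

open scoped RealInnerProductSpace

variable {Z O : Type*} [NormedAddCommGroup Z] [NormedSpace ℝ Z] [NormedAddCommGroup O]
  [NormedSpace ℝ O] {n : ℕ}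

namespace Certificate

variable {γ α : ℝ} {P : Certificate Z O n γ α} {b : ℝ} {ζ : ℝ → Z}
  {σ z : ℝ → EuclideanSpace ℝ (Fin n)}

variable (P) in
theorem energy_nonneg (ζ : Z) (σ z : EuclideanSpace ℝ (Fin n)) : 0 ≤ P.energy ζ σ z :=
  (mul_nonneg P.c₀_pos.le (sq_nonneg _)).trans ((P.bz_coercive ζ).trans (le_max_left _ _))

variable (P) in
theorem continuous_energy : Continuous fun s : Z × EuclideanSpace ℝ (Fin n) ×
    EuclideanSpace ℝ (Fin n) => P.energy s.1 s.2.1 s.2.2 := by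
  have : Continuous fun s : Z × EuclideanSpace ℝ (Fin n) × EuclideanSpace ℝ (Fin n) =>
      chi α s.2.1 s.2.2 :=
    ((continuous_c_smul P.α_pos).comp (by fun_prop)).prodMk (by fun_prop)
  unfold energy
  fun_prop

variable (P) in
theorem norm_sq_le_energy (ζ : Z) (σ z : EuclideanSpace ℝ (Fin n)) :
    P.c₀ / (1 + α⁻¹) ^ 2 * ‖(ζ, σ, z)‖ ^ 2 ≤ P.energy ζ σ z := by
  have hα := P.α_pos
  have hc₀ := P.c₀_pos
  have h1 : P.c₀ * ‖ζ‖ ^ 2 ≤ P.energy ζ σ z := (P.bz_coercive ζ).trans (le_max_left _ _)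
  have h2 : P.c₀ * ‖chi α σ z‖ ^ 2 ≤ P.energy ζ σ z :=
    (P.bx_coercive _).trans (le_max_right _ _)
  have e1 : ‖z‖ ≤ ‖chi α σ z‖ := norm_snd_le (chi α σ z)
  have e2 : ‖σ‖ ≤ α⁻¹ * ‖chi α σ z‖ := by
    have h3 : ‖c α σ • σ‖ ≤ ‖chi α σ z‖ := norm_fst_le (chi α σ z)
    rw [norm_smul, Real.norm_of_nonneg (c_pos hα σ).le] at h3
    rw [inv_mul_eq_div, le_div_iff₀' hα]
    exact (mul_le_mul_of_nonneg_right (le_c α σ) (norm_nonneg _)).trans h3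
  have hα' : 0 < α⁻¹ := inv_pos.2 hα
  have key : ∀ y M : ℝ, 0 ≤ y → 0 ≤ M → y ≤ (1 + α⁻¹) * M → P.c₀ * M ^ 2 ≤ P.energy ζ σ z →
      P.c₀ / (1 + α⁻¹) ^ 2 * y ^ 2 ≤ P.energy ζ σ z := by
    intro y M hy hM hyM hMe
    refine le_trans ?_ hMe
    rw [div_mul_eq_mul_div, div_le_iff₀ (by positivity), mul_assoc, ← mul_pow]
    gcongr
    linarith
  rw [Prod.norm_mk, Prod.norm_mk]
  have n1 := norm_nonneg ζ
  have n2 := norm_nonneg (chi α σ z)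
  rcases max_choice ‖ζ‖ (max ‖σ‖ ‖z‖) with h | h
  · rw [h]
    exact key _ _ n1 n1 (by nlinarith) h1
  · rw [h]
    exact key _ _ (by positivity) n2 (max_le (by nlinarith) (by nlinarith)) h2

theorem IsTrajectory.energy_add_integral_le (h : P.IsTrajectory b ζ σ z) {t₁ t₂ : ℝ}
    (h0 : 0 ≤ t₁) (h12 : t₁ ≤ t₂) (hb : t₂ ≤ b) :
    P.energy (ζ t₂) (σ t₂) (z t₂) + ∫ t in t₁..t₂, P.rate (ζ t) (σ t) (z t) ≤
      P.energy (ζ t₁) (σ t₁) (z t₁) := by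
  set D : ℝ → ℝ := fun t => P.rate (ζ t) (σ t) (z t) with hD
  have hDc : ContinuousOn D (Icc 0 b) := h.continuousOn_rate
  have hint : ∀ s ∈ Icc 0 b, ∀ t ∈ Icc 0 b, IntervalIntegrable D volume s t := fun s hs t ht =>
    (hDc.mono (uIcc_subset_Icc hs ht)).intervalIntegrable
  have hb0 : 0 ≤ b := h0.trans (h12.trans hb)
  have m0 : (0 : ℝ) ∈ Icc 0 b := left_mem_Icc.2 hb0
  have hsubt : ∀ s ∈ Icc 0 b, ∀ t ∈ Icc 0 b,
      (∫ u in (0:ℝ)..t, D u) - ∫ u in (0:ℝ)..s, D u = ∫ u in s..t, D u := fun s hs t ht =>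
    intervalIntegral.integral_interval_sub_left (hint 0 m0 t ht) (hint 0 m0 s hs)
  obtain ⟨L, hL⟩ := isCompact_Icc.exists_bound_of_continuousOn hDc
  have hL0 : 0 ≤ L := (norm_nonneg _).trans (hL 0 m0)
  have := h.energy_add_le (Φ := fun t => ∫ u in (0:ℝ)..t, D u)
    ⟨L, hL0, fun s hs t ht => by
      rw [hsubt s hs t ht]
      exact intervalIntegral.norm_integral_le_of_norm_le_const fun u hu =>
        hL u (uIcc_subset_Icc hs ht (uIoc_subset_uIcc hu))⟩
    (fun t ht => intervalIntegral.integral_hasDerivAt_right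
      (hint 0 m0 t (Ioo_subset_Icc_self ht))
      ((hDc.mono Ioo_subset_Icc_self).stronglyMeasurableAtFilter isOpen_Ioo t ht)
      (hDc.continuousAt (Icc_mem_nhds ht.1 ht.2))) h0 h12 hb
  have e := hsubt t₁ ⟨h0, h12.trans hb⟩ t₂ ⟨h0.trans h12, hb⟩
  linarith

theorem IsTrajectory.energy_le (h : P.IsTrajectory b ζ σ z) {t₁ t₂ : ℝ}
    (h0 : 0 ≤ t₁) (h12 : t₁ ≤ t₂) (hb : t₂ ≤ b) :
    P.energy (ζ t₂) (σ t₂) (z t₂) ≤ P.energy (ζ t₁) (σ t₁) (z t₁) := by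
  have := h.energy_add_integral_le h0 h12 hb
  have h2 : 0 ≤ ∫ t in t₁..t₂, P.rate (ζ t) (σ t) (z t) :=
    intervalIntegral.integral_nonneg h12 fun t _ => P.rate_nonneg _ _ _
  linarith

/-- The Lyapunov function is nonincreasing and integrable, hence `O(1 / t)`. -/
theorem mul_energy_le (h : ∀ b, 0 < b → P.IsTrajectory b ζ σ z) {t : ℝ} (ht : 0 < t) :
    P.ω * t * P.energy (ζ t) (σ t) (z t) ≤ P.energy (ζ 0) (σ 0) (z 0) := by
  have h1 := (h t ht).energy_add_integral_le le_rfl ht.le le_rfl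
  have h2 : ∫ _ in (0:ℝ)..t, P.ω * P.energy (ζ t) (σ t) (z t) ≤
      ∫ s in (0:ℝ)..t, P.rate (ζ s) (σ s) (z s) := by
    refine intervalIntegral.integral_mono_on ht.le (by simp) ?_ fun s hs => ?_
    · refine ContinuousOn.intervalIntegrable ?_
      rw [uIcc_of_le ht.le]
      exact (h t ht).continuousOn_rate
    · have h3 := (h t ht).energy_le hs.1 hs.2 le_rfl
      have h4 := mul_le_mul_of_nonneg_left h3 P.ω_pos.le
      rw [rate]
      linarith [sq_nonneg ‖P.h (ζ s)‖]
  rw [intervalIntegral.integral_const, smul_eq_mul, sub_zero] at h2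
  have h3 := P.energy_nonneg (ζ t) (σ t) (z t)
  linarith

theorem tendsto_zero (h : ∀ b, 0 < b → P.IsTrajectory b ζ σ z) :
    Tendsto (fun t => (ζ t, σ t, z t)) atTop (𝓝 0) := by
  have hα := P.α_pos
  have hK : 0 < P.c₀ / (1 + α⁻¹) ^ 2 := by have := P.c₀_pos; positivity
  set K := P.c₀ / (1 + α⁻¹) ^ 2
  have hω := P.ω_pos
  have h1 : Tendsto (fun t => ‖(ζ t, σ t, z t)‖ ^ 2) atTop (𝓝 0) := by
    refine squeeze_zero' (g := fun t => P.energy (ζ 0) (σ 0) (z 0) / (K * P.ω) / t)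
      (Eventually.of_forall fun t => sq_nonneg _) ?_ (tendsto_const_nhds.div_atTop tendsto_id)
    filter_upwards [eventually_gt_atTop 0] with t ht
    rw [div_div, le_div_iff₀ (by positivity)]
    have h2 := mul_energy_le h ht
    have h3 := mul_le_mul_of_nonneg_left (P.norm_sq_le_energy (ζ t) (σ t) (z t))
      (by positivity : 0 ≤ P.ω * t)
    linarith
  rw [tendsto_zero_iff_norm_tendsto_zero]
  have h2 := h1.sqrt
  simpa using h2

theorem integral_output_le (h : ∀ b, 0 < b → P.IsTrajectory b ζ σ z) :
    IntegrableOn (fun t => ‖P.h (ζ t)‖ ^ 2) (Ioi 0) ∧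
      ∫ t in Ioi (0 : ℝ), ‖P.h (ζ t)‖ ^ 2 ≤ P.energy (ζ 0) (σ 0) (z 0) := by
  have hcont : ∀ b, 0 < b → ContinuousOn (fun t => ‖P.h (ζ t)‖ ^ 2) (Icc 0 b) := fun b hb =>
    (P.h.continuous.comp_continuousOn (h b hb).continuousOn_ζ).norm.pow 2
  have hle : ∀ b, 0 < b → ∫ t in (0:ℝ)..b, ‖P.h (ζ t)‖ ^ 2 ≤ P.energy (ζ 0) (σ 0) (z 0) := by
    intro b hb
    have h1 := (h b hb).energy_add_integral_le le_rfl hb.le le_rfl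
    have h2 : ∫ t in (0:ℝ)..b, ‖P.h (ζ t)‖ ^ 2 ≤ ∫ s in (0:ℝ)..b, P.rate (ζ s) (σ s) (z s) := by
      refine intervalIntegral.integral_mono_on hb.le ?_ ?_ fun s hs => ?_
      · refine ContinuousOn.intervalIntegrable ?_
        rw [uIcc_of_le hb.le]
        exact hcont b hb
      · refine ContinuousOn.intervalIntegrable ?_
        rw [uIcc_of_le hb.le]
        exact (h b hb).continuousOn_rate
      · rw [rate]
        linarith [mul_nonneg P.ω_pos.le (P.energy_nonneg (ζ s) (σ s) (z s))]
    linarith [P.energy_nonneg (ζ b) (σ b) (z b)]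
  have hint : IntegrableOn (fun t => ‖P.h (ζ t)‖ ^ 2) (Ioi 0) := by
    refine integrableOn_Ioi_of_intervalIntegral_norm_bounded (P.energy (ζ 0) (σ 0) (z 0)) 0
      (l := atTop) (b := fun b : ℝ => b) (fun b => ?_) tendsto_id ?_
    · rcases le_or_gt b 0 with hb | hb
      · simp [Ioc_eq_empty (not_lt.2 hb)]
      · exact ((hcont b hb).integrableOn_Icc).mono_set Ioc_subset_Icc_self
    · filter_upwards [eventually_gt_atTop 0] with b hb
      simpa using hle b hb
  refine ⟨hint, le_of_tendsto (intervalIntegral_tendsto_integral_Ioi 0 hint tendsto_id) ?_⟩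
  filter_upwards [eventually_gt_atTop 0] with b hb using hle b hb

end Certificate

end Consequences

/-! ### Quadratic forms of the matrix inequalities -/

section Matrices

/-- A positive definite form dominates a positive multiple of any other form. -/
theorem PosDef.exists_mul_le {ι : Type*} [Fintype ι] {M : Matrix ι ι ℝ} (hM : M.PosDef)
    (N : Matrix ι ι ℝ) : ∃ ε > 0, ∀ v : ι → ℝ, ε * (v ⬝ᵥ N *ᵥ v) ≤ v ⬝ᵥ M *ᵥ v := by
  have hcont : ∀ L : Matrix ι ι ℝ, Continuous fun v : ι → ℝ => v ⬝ᵥ L *ᵥ v := fun L =>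
    continuous_id.dotProduct (continuous_const.matrix_mulVec continuous_id)
  have hS : IsCompact (Metric.sphere (0 : ι → ℝ) 1) := isCompact_sphere _ _
  obtain ⟨C, hC⟩ := hS.exists_bound_of_continuousOn (hcont N).continuousOn
  -- it suffices to compare the forms on the unit sphere
  obtain ⟨m, hm, hm'⟩ : ∃ m > 0, ∀ v ∈ Metric.sphere (0 : ι → ℝ) 1, m ≤ v ⬝ᵥ M *ᵥ v := by
    rcases (Metric.sphere (0 : ι → ℝ) 1).eq_empty_or_nonempty with h | h
    · exact ⟨1, one_pos, by simp [h]⟩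
    · obtain ⟨v₀, hv₀, hmin⟩ := hS.exists_isMinOn h (hcont M).continuousOn
      have hne : v₀ ≠ 0 := by
        rintro rfl
        simp at hv₀
      exact ⟨_, by simpa using hM.dotProduct_mulVec_pos hne, fun v hv => hmin hv⟩
  refine ⟨m / (|C| + 1), by positivity, fun v => ?_⟩
  by_cases hv : v = 0
  · simp [hv]
  have hv' : 0 < ‖v‖ := norm_pos_iff.2 hv
  set w := ‖v‖⁻¹ • v with hw
  have hws : w ∈ Metric.sphere (0 : ι → ℝ) 1 := by
    rw [mem_sphere_zero_iff_norm, hw, norm_smul, norm_inv, norm_norm, inv_mul_cancel₀ hv'.ne']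
  have hvw : v = ‖v‖ • w := by rw [hw, smul_smul, mul_inv_cancel₀ hv'.ne', one_smul]
  have key : m / (|C| + 1) * (w ⬝ᵥ N *ᵥ w) ≤ w ⬝ᵥ M *ᵥ w := by
    refine le_trans ?_ (hm' w hws)
    have h1 : w ⬝ᵥ N *ᵥ w ≤ |C| + 1 := by
      have := (le_abs_self _).trans (hC w hws)
      linarith [le_abs_self C]
    calc _ ≤ m / (|C| + 1) * (|C| + 1) := by gcongr
      _ = m := by field_simp
  have e : ∀ L : Matrix ι ι ℝ, v ⬝ᵥ L *ᵥ v = ‖v‖ * ‖v‖ * (w ⬝ᵥ L *ᵥ w) := by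
    intro L
    nth_rewrite 1 [hvw]
    nth_rewrite 2 [hvw]
    rw [Matrix.mulVec_smul, smul_dotProduct, dotProduct_smul, smul_eq_mul, smul_eq_mul, mul_assoc]
  rw [e, e, mul_left_comm]
  gcongr

/-- The weighted inequality `2 ⟨u, w⟩ ≤ a ‖u‖² + a⁻¹ ‖w‖²`. -/
theorem two_mul_dotProduct_le {ι : Type*} [Fintype ι] {a : ℝ} (ha : 0 < a) (u w : ι → ℝ) :
    2 * (u ⬝ᵥ w) ≤ a * (u ⬝ᵥ u) + a⁻¹ * (w ⬝ᵥ w) := by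
  have h : 0 ≤ (a • u - w) ⬝ᵥ (a • u - w) :=
    Finset.sum_nonneg fun i _ => mul_self_nonneg _
  have e : (a • u - w) ⬝ᵥ (a • u - w) = a * (a * (u ⬝ᵥ u) + a⁻¹ * (w ⬝ᵥ w) - 2 * (u ⬝ᵥ w)) := by
    simp only [sub_dotProduct, dotProduct_sub, smul_dotProduct, dotProduct_smul, smul_eq_mul,
      dotProduct_comm w u]
    field_simp
    ring
  rw [e] at h
  have := nonneg_of_mul_nonneg_right h ha
  linarith

theorem dotProduct_fromBlocks_mulVec {ι κ : Type*} [Fintype ι] [Fintype κ] (A : Matrix ι ι ℝ)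
    (M : Matrix κ ι ℝ) (D : Matrix κ κ ℝ) (u : ι → ℝ) (v : κ → ℝ) :
    Sum.elim u v ⬝ᵥ Matrix.fromBlocks A Mᵀ M D *ᵥ Sum.elim u v =
      u ⬝ᵥ A *ᵥ u + 2 * (v ⬝ᵥ M *ᵥ u) + v ⬝ᵥ D *ᵥ v := by
  rw [Matrix.fromBlocks_mulVec, sumElim_dotProduct_sumElim]
  simp only [Sum.elim_comp_inl, Sum.elim_comp_inr, dotProduct_add,
    Matrix.dotProduct_transpose_mulVec]
  ring

/-- The concatenation of four vectors. -/
def blockVec {n : ℕ} (a : Fin 4 → Fin n → ℝ) : Fin 4 × Fin n → ℝ := fun p => a p.1 p.2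

theorem stack_mulVec {n : ℕ} {ι : Type*} [Fintype ι] (M₁ M₂ M₃ M₄ : Matrix (Fin n) ι ℝ)
    (u : ι → ℝ) : stack M₁ M₂ M₃ M₄ *ᵥ u =
      blockVec ![M₁ *ᵥ u, M₂ *ᵥ u, M₃ *ᵥ u, M₄ *ᵥ u] := by
  ext ⟨j, i⟩
  fin_cases j <;> rfl

theorem blockVec_dotProduct_blockVec {n : ℕ} (a b : Fin 4 → Fin n → ℝ) :
    blockVec a ⬝ᵥ blockVec b = a 0 ⬝ᵥ b 0 + a 1 ⬝ᵥ b 1 + a 2 ⬝ᵥ b 2 + a 3 ⬝ᵥ b 3 := by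
  simp only [blockVec, dotProduct, Fintype.sum_prod_type, Fin.sum_univ_four]

theorem Zd_mulVec_blockVec {n : ℕ} (z : Fin 4 → ℝ) (a : Fin 4 → Fin n → ℝ) :
    Zd n z *ᵥ blockVec a = blockVec fun j => z j • a j := by
  ext p
  simp [Zd, blockVec, Matrix.mulVec_diagonal]

theorem G₀_mulVec {n : ℕ} (x₁ x₂ : Fin n → ℝ) : G₀ n *ᵥ Sum.elim x₁ x₂ = x₁ := by
  rw [G₀, Matrix.fromCols_mulVec_sumElim]; simp

/-- The quadratic form of the nonlinear inequality at `(u, v)`, with `x = X u`. -/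
theorem dotProduct_lmiN_mulVec {n m : ℕ} (γ α ρ : ℝ) (D : Matrix (Fin n) (Fin n) ℝ)
    (B : Matrix (Fin n) (Fin m) ℝ) {X : Matrix (Fin n ⊕ Fin n) (Fin n ⊕ Fin n) ℝ}
    (hX : Xᵀ = X) (Y : Matrix (Fin m) (Fin n ⊕ Fin n) ℝ) (z : Fin 4 → ℝ)
    {u₁ u₂ x₁ x₂ : Fin n → ℝ} (hx : X *ᵥ Sum.elim u₁ u₂ = Sum.elim x₁ x₂)
    (v : Fin 4 → Fin n → ℝ) :
    Sum.elim (Sum.elim u₁ u₂) (blockVec v) ⬝ᵥ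
        lmiN γ α ρ D B X Y z *ᵥ Sum.elim (Sum.elim u₁ u₂) (blockVec v) =
      2 * (u₂ ⬝ᵥ x₁) + 2 * (u₁ ⬝ᵥ B *ᵥ Y *ᵥ Sum.elim u₁ u₂) + ρ * (u₁ ⬝ᵥ x₁ + u₂ ⬝ᵥ x₂) +
        (z 0 / 4 * (u₁ ⬝ᵥ u₁) + z 1 * (u₂ ⬝ᵥ u₂) + z 2 * (u₁ ⬝ᵥ u₁) + z 3 * (u₁ ⬝ᵥ u₁)) +
        2 * (v 0 ⬝ᵥ B *ᵥ Y *ᵥ Sum.elim u₁ u₂ + γ⁻¹ * (v 1 ⬝ᵥ x₁) + α⁻¹ * (v 2 ⬝ᵥ D *ᵥ x₁)) -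
        (z 0 * (v 0 ⬝ᵥ v 0) + z 1 * (v 1 ⬝ᵥ v 1) + z 2 * (v 2 ⬝ᵥ v 2) + z 3 * (v 3 ⬝ᵥ v 3)) := by
  set u := Sum.elim u₁ u₂ with hu
  have e1 : A₀ n *ᵥ Sum.elim x₁ x₂ = Sum.elim (0 : Fin n → ℝ) x₁ := by
    rw [A₀, Matrix.fromBlocks_mulVec]; simp
  have e2 : ∀ y, u ⬝ᵥ (B₀ B *ᵥ y) = u₁ ⬝ᵥ B *ᵥ y := by
    intro y
    rw [B₀, Matrix.fromRows_mulVec, hu, sumElim_dotProduct_sumElim]; simp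
  have e3 : X * (A₀ n)ᵀ = (A₀ n * X)ᵀ := by rw [Matrix.transpose_mul, hX]
  have e4 : Yᵀ * (B₀ B)ᵀ = (B₀ B * Y)ᵀ := by rw [Matrix.transpose_mul]
  have e5 : T₀ n *ᵥ u = blockVec ![(1 / 2 : ℝ) • u₁, u₂, u₁, u₁] := by
    rw [T₀, stack_mulVec]
    have g1 : (E₀ n)ᵀ *ᵥ u = (1 / 2 : ℝ) • u₁ := by
      rw [E₀, Matrix.transpose_fromRows, hu, Matrix.fromCols_mulVec_sumElim]
      simp [Matrix.transpose_smul, Matrix.smul_mulVec]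
    have g2 : (F₀ n)ᵀ *ᵥ u = u₂ := by
      rw [F₀, Matrix.transpose_fromRows, hu, Matrix.fromCols_mulVec_sumElim]; simp
    have g3 : G₀ n *ᵥ u = u₁ := G₀_mulVec u₁ u₂
    rw [g1, g2, g3]
  have e6 : u ⬝ᵥ ((T₀ n)ᵀ * Zd n z * T₀ n) *ᵥ u =
      z 0 / 4 * (u₁ ⬝ᵥ u₁) + z 1 * (u₂ ⬝ᵥ u₂) + z 2 * (u₁ ⬝ᵥ u₁) + z 3 * (u₁ ⬝ᵥ u₁) := by
    rw [← Matrix.mulVec_mulVec, ← Matrix.mulVec_mulVec, Matrix.dotProduct_transpose_mulVec, e5,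
      Zd_mulVec_blockVec, blockVec_dotProduct_blockVec]
    simp
    ring
  have e7 : stackXY γ α D B X Y *ᵥ u =
      blockVec ![B *ᵥ Y *ᵥ u, γ⁻¹ • x₁, α⁻¹ • D *ᵥ x₁, 0] := by
    rw [stackXY, stack_mulVec, Matrix.smul_mulVec, Matrix.smul_mulVec, Matrix.mul_assoc D,
      ← Matrix.mulVec_mulVec, ← Matrix.mulVec_mulVec, ← Matrix.mulVec_mulVec,
      ← Matrix.mulVec_mulVec, hx, G₀_mulVec, Matrix.zero_mulVec]
  rw [lmiN, dotProduct_fromBlocks_mulVec, e7, blockVec_dotProduct_blockVec, Matrix.neg_mulVec,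
    Zd_mulVec_blockVec, dotProduct_neg, blockVec_dotProduct_blockVec, e3, e4]
  simp only [Matrix.add_mulVec, dotProduct_add]
  rw [e6]
  simp only [Matrix.dotProduct_transpose_mulVec,
    ← Matrix.mulVec_mulVec, Matrix.smul_mulVec, dotProduct_smul, hx, e1, e2]
  rw [hu, sumElim_dotProduct_sumElim, sumElim_dotProduct_sumElim]
  simp
  ring

/-- The nonlinear vertex inequality as a dissipation inequality, robust in the perturbations
`w₁, …, w₄`: completion of squares with the weights `z`. -/
theorem exists_lmiN_dissipation {n m : ℕ} {γ α ρ : ℝ} {D : Matrix (Fin n) (Fin n) ℝ}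
    {B : Matrix (Fin n) (Fin m) ℝ} {X : Matrix (Fin n ⊕ Fin n) (Fin n ⊕ Fin n) ℝ}
    (hX : Xᵀ = X) {Y : Matrix (Fin m) (Fin n ⊕ Fin n) ℝ} {z : Fin 4 → ℝ} (hz : ∀ j, 0 < z j)
    (h : (-lmiN γ α ρ D B X Y z).PosDef) :
    ∃ ε > 0, ∀ u₁ u₂ x₁ x₂ w₁ w₂ w₃ w₄ : Fin n → ℝ, X *ᵥ Sum.elim u₁ u₂ = Sum.elim x₁ x₂ →
      w₁ ⬝ᵥ w₁ ≤ (B *ᵥ Y *ᵥ Sum.elim u₁ u₂) ⬝ᵥ (B *ᵥ Y *ᵥ Sum.elim u₁ u₂) →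
      w₂ ⬝ᵥ w₂ ≤ γ⁻¹ ^ 2 * (x₁ ⬝ᵥ x₁) → w₃ ⬝ᵥ w₃ ≤ α⁻¹ ^ 2 * (D *ᵥ x₁ ⬝ᵥ D *ᵥ x₁) →
      2 * (u₁ ⬝ᵥ (B *ᵥ Y *ᵥ Sum.elim u₁ u₂ + (1 / 2 : ℝ) • w₁ + w₃ + w₄) +
        u₂ ⬝ᵥ (x₁ + w₂)) + (ρ + ε) * (u₁ ⬝ᵥ x₁ + u₂ ⬝ᵥ x₂) ≤ (z 3)⁻¹ * (w₄ ⬝ᵥ w₄) := by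
  obtain ⟨ε, hε, hle⟩ := PosDef.exists_mul_le h (Matrix.fromBlocks X 0ᵀ 0 0)
  refine ⟨ε, hε, fun u₁ u₂ x₁ x₂ w₁ w₂ w₃ w₄ hx h1 h2 h3 => ?_⟩
  set y := B *ᵥ Y *ᵥ Sum.elim u₁ u₂ with hy
  -- the second block `Z_d⁻¹ M u`, with `M` the off-diagonal block, maximizes the form at fixed `u`
  have key := hle (Sum.elim (Sum.elim u₁ u₂) (blockVec
    ![(z 0)⁻¹ • y, (z 1)⁻¹ • γ⁻¹ • x₁, (z 2)⁻¹ • α⁻¹ • D *ᵥ x₁, 0]))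
  rw [Matrix.neg_mulVec, dotProduct_neg, dotProduct_lmiN_mulVec γ α ρ D B hX Y z hx,
    dotProduct_fromBlocks_mulVec, hx, sumElim_dotProduct_sumElim, ← hy] at key
  have z0 := hz 0
  have z1 := hz 1
  have z2 := hz 2
  have z3 := hz 3
  have y1 := two_mul_dotProduct_le (a := z 0 / 4) (by positivity) u₁ ((1 / 2 : ℝ) • w₁)
  have y2 := two_mul_dotProduct_le z1 u₂ w₂
  have y3 := two_mul_dotProduct_le z2 u₁ w₃
  have y4 := two_mul_dotProduct_le z3 u₁ w₄
  have h1' := mul_le_mul_of_nonneg_left h1 (inv_pos.2 z0).le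
  have h2' := mul_le_mul_of_nonneg_left h2 (inv_pos.2 z1).le
  have h3' := mul_le_mul_of_nonneg_left h3 (inv_pos.2 z2).le
  have c0 : z 0 * ((z 0)⁻¹ * ((z 0)⁻¹ * (y ⬝ᵥ y))) = (z 0)⁻¹ * (y ⬝ᵥ y) := by field_simp
  have c1 : z 1 * ((z 1)⁻¹ * (γ⁻¹ * ((z 1)⁻¹ * (γ⁻¹ * (x₁ ⬝ᵥ x₁))))) =
      (z 1)⁻¹ * (γ⁻¹ ^ 2 * (x₁ ⬝ᵥ x₁)) := by field_simp
  have c2 : z 2 * ((z 2)⁻¹ * (α⁻¹ * ((z 2)⁻¹ * (α⁻¹ * (D *ᵥ x₁ ⬝ᵥ D *ᵥ x₁))))) =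
      (z 2)⁻¹ * (α⁻¹ ^ 2 * (D *ᵥ x₁ ⬝ᵥ D *ᵥ x₁)) := by field_simp
  have c3 : (z 0 / 4)⁻¹ * (1 / 2 * (1 / 2 * (w₁ ⬝ᵥ w₁))) = (z 0)⁻¹ * (w₁ ⬝ᵥ w₁) := by
    field_simp; norm_num
  simp only [neg_sub, Matrix.cons_val, smul_dotProduct, dotProduct_smul, smul_eq_mul,
    dotProduct_zero, mul_zero, add_zero, c0, c1, c2, Matrix.zero_mulVec] at key
  simp only [smul_dotProduct, dotProduct_smul, smul_eq_mul, c3] at y1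
  simp only [dotProduct_add, dotProduct_smul, smul_eq_mul]
  linarith

/-- The linear vertex inequality as a dissipation inequality. -/
theorem exists_lmiL_dissipation {r n m q : ℕ} {α ρ : ℝ} {H : Matrix (Fin q) (Fin r) ℝ}
    {J : Matrix (Fin q) (Fin m) ℝ} {A : Matrix (Fin r) (Fin r) ℝ} {E : Matrix (Fin r) (Fin n) ℝ}
    {Q : Matrix (Fin r) (Fin r) ℝ} (hQ : Qᵀ = Q)
    {X : Matrix (Fin n ⊕ Fin n) (Fin n ⊕ Fin n) ℝ} (hX : Xᵀ = X) {W : Matrix (Fin m) (Fin r) ℝ}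
    (h : (-lmiL α ρ H J A E Q X W).PosDef) :
    ∃ ε > 0, ∀ (p : Fin r → ℝ) (u : Fin n ⊕ Fin n → ℝ) (x₁ x₂ : Fin n → ℝ),
      X *ᵥ u = Sum.elim x₁ x₂ →
      2 * (p ⬝ᵥ (A *ᵥ Q *ᵥ p + α⁻¹ • E *ᵥ x₁)) + (ρ + ε) * (p ⬝ᵥ Q *ᵥ p) +
        ((H * Q + J * W) *ᵥ p) ⬝ᵥ ((H * Q + J * W) *ᵥ p) ≤ ρ * (u ⬝ᵥ X *ᵥ u) := by
  obtain ⟨ε, hε, hle⟩ := PosDef.exists_mul_le h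
    (Matrix.fromBlocks (Matrix.fromBlocks Q 0ᵀ 0 0) 0ᵀ 0 0)
  refine ⟨ε, hε, fun p u x₁ x₂ hx => ?_⟩
  have key := hle (Sum.elim (Sum.elim p u) ((H * Q + J * W) *ᵥ p))
  have e1 : Q * Aᵀ = (A * Q)ᵀ := by rw [Matrix.transpose_mul, hQ]
  have e2 : X * (G₀ n)ᵀ * Eᵀ = (E * (G₀ n * X))ᵀ := by
    rw [Matrix.transpose_mul, Matrix.transpose_mul, hX]
  rw [Matrix.neg_mulVec, dotProduct_neg, lmiL, dotProduct_fromBlocks_mulVec,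
    dotProduct_fromBlocks_mulVec, dotProduct_fromBlocks_mulVec, dotProduct_fromBlocks_mulVec,
    Matrix.fromCols_mulVec_sumElim, e1, e2] at key
  simp only [Matrix.add_mulVec _ _ p, dotProduct_add, Matrix.dotProduct_transpose_mulVec,
    Matrix.smul_mulVec, dotProduct_smul, smul_eq_mul, Matrix.neg_mulVec, dotProduct_neg,
    Matrix.zero_mulVec, dotProduct_zero, mul_zero, add_zero, Matrix.one_mulVec] at key
  rw [← Matrix.mulVec_mulVec, ← Matrix.mulVec_mulVec, ← Matrix.mulVec_mulVec, hx, G₀_mulVec] at key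
  simp only [Matrix.add_mulVec, dotProduct_add, dotProduct_smul, smul_eq_mul,
    ← Matrix.mulVec_mulVec] at key ⊢
  rw [hx]
  linarith

/-- The coupling vertex inequality as a comparison of quadratic forms. -/
theorem lmiC_le {r n m q : ℕ} {α ρ κ : ℝ} (hα : 0 < α) (hκ : 0 < κ)
    {H : Matrix (Fin q) (Fin r) ℝ}
    {J : Matrix (Fin q) (Fin m) ℝ} {C : Matrix (Fin n) (Fin r) ℝ} {B : Matrix (Fin n) (Fin m) ℝ}
    {Q : Matrix (Fin r) (Fin r) ℝ} {W : Matrix (Fin m) (Fin r) ℝ}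
    (h : (lmiC α ρ H J C B Q W κ).PosDef) (p : Fin r → ℝ) :
    κ⁻¹ * ((C * Q + B * W) *ᵥ p ⬝ᵥ (C * Q + B * W) *ᵥ p) +
      α⁻¹ * ((H * Q + J * W) *ᵥ p ⬝ᵥ (H * Q + J * W) *ᵥ p) ≤ ρ * (p ⬝ᵥ Q *ᵥ p) := by
  have key := h.posSemidef.dotProduct_mulVec_nonneg
    (Sum.elim (Sum.elim p (-κ⁻¹ • (C * Q + B * W) *ᵥ p)) (-α⁻¹ • (H * Q + J * W) *ᵥ p))
  rw [star_trivial, lmiC, dotProduct_fromBlocks_mulVec, dotProduct_fromBlocks_mulVec,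
    Matrix.fromCols_mulVec_sumElim] at key
  set y := (C * Q + B * W) *ᵥ p
  set ξ := (H * Q + J * W) *ᵥ p
  simp only [Matrix.smul_mulVec, dotProduct_smul, smul_dotProduct, smul_eq_mul,
    Matrix.zero_mulVec, add_zero, Matrix.one_mulVec] at key
  have c1 : κ * (-κ⁻¹ * (-κ⁻¹ * (y ⬝ᵥ y))) = κ⁻¹ * (y ⬝ᵥ y) := by field_simp
  have c2 : α * (-α⁻¹ * (-α⁻¹ * (ξ ⬝ᵥ ξ))) = α⁻¹ * (ξ ⬝ᵥ ξ) := by field_simp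
  rw [c1, c2] at key
  linarith

/-- The bordered inequality bounds the quadratic form of the inverse matrix. -/
theorem bordered_le {ι : Type*} [Fintype ι] [DecidableEq ι] {θ : ℝ} {v : ι → ℝ}
    {M : Matrix ι ι ℝ} (hM : M.PosDef) (h : (bordered θ v M).PosDef) :
    v ⬝ᵥ M⁻¹ *ᵥ v ≤ θ := by
  -- the minimum over the second block of the form with first block `1` is `θ - vᵀ M⁻¹ v`
  have key := h.posSemidef.dotProduct_mulVec_nonneg
    (Sum.elim (fun _ => (1 : ℝ)) (-(M⁻¹ *ᵥ v)))
  have e : bordered θ v M = Matrix.fromBlocks (Matrix.of fun _ _ => θ)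
      (Matrix.replicateCol Unit v)ᵀ (Matrix.replicateCol Unit v) M := by
    rw [bordered, Matrix.transpose_replicateCol]
  have e2 : Matrix.replicateCol Unit v *ᵥ (fun _ => (1 : ℝ)) = v := by
    ext i; simp [Matrix.mulVec, dotProduct]
  have e3 : M *ᵥ M⁻¹ *ᵥ v = v := by
    rw [Matrix.mulVec_mulVec,
      Matrix.mul_nonsing_inv _ ((Matrix.isUnit_iff_isUnit_det _).1 hM.isUnit), Matrix.one_mulVec]
  rw [star_trivial, e, dotProduct_fromBlocks_mulVec, e2, Matrix.mulVec_neg, e3, neg_dotProduct,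
    neg_dotProduct_neg, dotProduct_comm _ v] at key
  have e4 : (fun _ : Unit => (1 : ℝ)) ⬝ᵥ (Matrix.of fun _ _ : Unit => θ) *ᵥ (fun _ => 1) = θ := by
    simp [Matrix.mulVec, dotProduct]
  rw [e4] at key
  linarith

theorem posDef_of_bordered {ι : Type*} [Fintype ι] [DecidableEq ι] {θ : ℝ} {v : ι → ℝ}
    {M : Matrix ι ι ℝ} (h : (bordered θ v M).PosDef) : M.PosDef :=
  h.submatrix (e := Sum.inr) Sum.inr_injective

/-- The weights of a feasible point are positive, unless `n = 0`, when they are irrelevant. -/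
theorem Zd_pos {n m : ℕ} {γ α ρ : ℝ} {D : Matrix (Fin n) (Fin n) ℝ}
    {B : Matrix (Fin n) (Fin m) ℝ} {X : Matrix (Fin n ⊕ Fin n) (Fin n ⊕ Fin n) ℝ}
    {Y : Matrix (Fin m) (Fin n ⊕ Fin n) ℝ} {z : Fin 4 → ℝ}
    (h : (-lmiN γ α ρ D B X Y z).PosDef) (i : Fin n) (j : Fin 4) : 0 < z j := by
  have := h.diag_pos (i := Sum.inr (j, i))
  simpa [lmiN, Zd] using this

end Matrices

/-! ### Convexity of the matrix inequalities -/

section Convexity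

theorem PosDef.smul_add_smul {ι : Type*} [Finite ι] {M N : Matrix ι ι ℝ} (hM : M.PosDef)
    (hN : N.PosDef) {a b : ℝ} (ha : 0 ≤ a) (hb : 0 ≤ b) (hab : a + b = 1) :
    (a • M + b • N).PosDef := by
  have := Fintype.ofFinite ι
  rcases ha.eq_or_lt with rfl | ha
  · rw [zero_add] at hab
    simpa [hab] using hN
  · exact (hM.smul ha).add_posSemidef (hN.posSemidef.smul hb)

theorem stack_smul_add_smul {n : ℕ} {ι : Type*} (a b : ℝ)
    (M₁ M₂ M₃ M₄ N₁ N₂ N₃ N₄ : Matrix (Fin n) ι ℝ) :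
    stack (a • M₁ + b • N₁) (a • M₂ + b • N₂) (a • M₃ + b • N₃) (a • M₄ + b • N₄) =
      a • stack M₁ M₂ M₃ M₄ + b • stack N₁ N₂ N₃ N₄ := by
  ext ⟨j, i⟩ k
  fin_cases j <;> rfl

theorem Zd_smul_add_smul (n : ℕ) (a b : ℝ) (z w : Fin 4 → ℝ) :
    Zd n (a • z + b • w) = a • Zd n z + b • Zd n w := by
  rw [Zd, Zd, Zd, ← Matrix.diagonal_smul, ← Matrix.diagonal_smul, Matrix.diagonal_add]
  rfl

theorem B₀_smul_add_smul {n m : ℕ} (a b : ℝ) (B B' : Matrix (Fin n) (Fin m) ℝ) :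
    B₀ (a • B + b • B') = a • B₀ B + b • B₀ B' := by
  ext i j
  rcases i with i | i <;> simp [B₀]

theorem fromBlocks_smul_add_smul {ι κ : Type*} (a b : ℝ) (A A' : Matrix ι ι ℝ)
    (M M' : Matrix κ ι ℝ) (D D' : Matrix κ κ ℝ) :
    Matrix.fromBlocks (a • A + b • A') (a • M + b • M')ᵀ (a • M + b • M') (a • D + b • D') =
      a • Matrix.fromBlocks A Mᵀ M D + b • Matrix.fromBlocks A' M'ᵀ M' D' := by
  simp [Matrix.fromBlocks_smul, Matrix.fromBlocks_add]

theorem fromCols_smul_add_smul {ι κ₁ κ₂ : Type*} (a b : ℝ) (M M' : Matrix ι κ₁ ℝ) :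
    Matrix.fromCols (a • M + b • M') (0 : Matrix ι κ₂ ℝ) =
      a • Matrix.fromCols M 0 + b • Matrix.fromCols M' 0 := by
  ext i j
  rcases j with j | j <;> simp

theorem eq_smul_add_smul {V : Type*} [AddCommGroup V] [Module ℝ V] {a b : ℝ} (hab : a + b = 1)
    (x : V) : x = a • x + b • x := by
  rw [← add_smul, hab, one_smul]

variable {r n m q : ℕ} (γ α ρ : ℝ)

theorem lmiN_smul_add_smul (D : Matrix (Fin n) (Fin n) ℝ) (B : Matrix (Fin n) (Fin m) ℝ)
    (X X' : Matrix (Fin n ⊕ Fin n) (Fin n ⊕ Fin n) ℝ) (Y Y' : Matrix (Fin m) (Fin n ⊕ Fin n) ℝ)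
    (z z' : Fin 4 → ℝ) (a b : ℝ) :
    lmiN γ α ρ D B (a • X + b • X') (a • Y + b • Y') (a • z + b • z') =
      a • lmiN γ α ρ D B X Y z + b • lmiN γ α ρ D B X' Y' z' := by
  have e : stackXY γ α D B (a • X + b • X') (a • Y + b • Y') =
      a • stackXY γ α D B X Y + b • stackXY γ α D B X' Y' := by
    rw [stackXY, stackXY, stackXY, ← stack_smul_add_smul]
    congr 1 <;> (try simp only [Matrix.mul_add, Matrix.mul_smul, smul_add]) <;> module
  rw [lmiN, lmiN, lmiN, ← fromBlocks_smul_add_smul, e, Zd_smul_add_smul]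
  congr 1
  · simp only [Matrix.transpose_add, Matrix.transpose_smul, Matrix.mul_add,
      Matrix.add_mul, Matrix.mul_smul, Matrix.smul_mul]
    module
  · module

theorem lmiN_plant_smul_add_smul (D D' : Matrix (Fin n) (Fin n) ℝ)
    (B B' : Matrix (Fin n) (Fin m) ℝ)
    (X : Matrix (Fin n ⊕ Fin n) (Fin n ⊕ Fin n) ℝ) (Y : Matrix (Fin m) (Fin n ⊕ Fin n) ℝ)
    (z : Fin 4 → ℝ) {a b : ℝ} (hab : a + b = 1) :
    lmiN γ α ρ (a • D + b • D') (a • B + b • B') X Y z =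
      a • lmiN γ α ρ D B X Y z + b • lmiN γ α ρ D' B' X Y z := by
  have e : stackXY γ α (a • D + b • D') (a • B + b • B') X Y =
      a • stackXY γ α D B X Y + b • stackXY γ α D' B' X Y := by
    rw [stackXY, stackXY, stackXY, ← stack_smul_add_smul, ← eq_smul_add_smul hab]
    congr 1 <;> (try simp only [Matrix.add_mul, Matrix.smul_mul, smul_add]) <;> module
  rw [lmiN, lmiN, lmiN, ← fromBlocks_smul_add_smul, e, ← eq_smul_add_smul hab]
  congr 1
  nth_rewrite 1 [eq_smul_add_smul hab ((T₀ n)ᵀ * Zd n z * T₀ n), eq_smul_add_smul hab (ρ • X),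
    eq_smul_add_smul hab (A₀ n * X), eq_smul_add_smul hab (X * (A₀ n)ᵀ)]
  simp only [B₀_smul_add_smul, Matrix.transpose_add, Matrix.transpose_smul, Matrix.mul_add,
    Matrix.add_mul, Matrix.mul_smul, Matrix.smul_mul]
  module

theorem lmiL_smul_add_smul (H : Matrix (Fin q) (Fin r) ℝ) (J : Matrix (Fin q) (Fin m) ℝ)
    (A : Matrix (Fin r) (Fin r) ℝ) (E : Matrix (Fin r) (Fin n) ℝ)
    (Q Q' : Matrix (Fin r) (Fin r) ℝ) (X X' : Matrix (Fin n ⊕ Fin n) (Fin n ⊕ Fin n) ℝ)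
    (W W' : Matrix (Fin m) (Fin r) ℝ) {a b : ℝ} (hab : a + b = 1) :
    lmiL α ρ H J A E (a • Q + b • Q') (a • X + b • X') (a • W + b • W') =
      a • lmiL α ρ H J A E Q X W + b • lmiL α ρ H J A E Q' X' W' := by
  have e : H * (a • Q + b • Q') + J * (a • W + b • W') =
      a • (H * Q + J * W) + b • (H * Q' + J * W') := by
    simp only [Matrix.mul_add, Matrix.mul_smul]; module
  have e2 : α⁻¹ • ((a • X + b • X') * (G₀ n)ᵀ * Eᵀ) =
      a • (α⁻¹ • (X * (G₀ n)ᵀ * Eᵀ)) + b • (α⁻¹ • (X' * (G₀ n)ᵀ * Eᵀ)) := by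
    simp only [Matrix.add_mul, Matrix.smul_mul]; module
  rw [lmiL, lmiL, lmiL, ← fromBlocks_smul_add_smul, e, e2, fromCols_smul_add_smul,
    ← fromBlocks_smul_add_smul, ← eq_smul_add_smul hab]
  congr 2
  · simp only [Matrix.mul_add, Matrix.add_mul, Matrix.mul_smul, Matrix.smul_mul]
    module
  · module

theorem lmiL_plant_smul_add_smul (H : Matrix (Fin q) (Fin r) ℝ) (J : Matrix (Fin q) (Fin m) ℝ)
    (A A' : Matrix (Fin r) (Fin r) ℝ) (E E' : Matrix (Fin r) (Fin n) ℝ)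
    (Q : Matrix (Fin r) (Fin r) ℝ) (X : Matrix (Fin n ⊕ Fin n) (Fin n ⊕ Fin n) ℝ)
    (W : Matrix (Fin m) (Fin r) ℝ) {a b : ℝ} (hab : a + b = 1) :
    lmiL α ρ H J (a • A + b • A') (a • E + b • E') Q X W =
      a • lmiL α ρ H J A E Q X W + b • lmiL α ρ H J A' E' Q X W := by
  have e2 : α⁻¹ • (X * (G₀ n)ᵀ * (a • E + b • E')ᵀ) =
      a • (α⁻¹ • (X * (G₀ n)ᵀ * Eᵀ)) + b • (α⁻¹ • (X * (G₀ n)ᵀ * E'ᵀ)) := by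
    simp only [Matrix.transpose_add, Matrix.transpose_smul, Matrix.mul_add, Matrix.mul_smul]; module
  rw [lmiL, lmiL, lmiL, ← fromBlocks_smul_add_smul, e2, ← eq_smul_add_smul hab,
    ← fromBlocks_smul_add_smul, ← eq_smul_add_smul hab, ← eq_smul_add_smul hab]
  congr 2
  nth_rewrite 1 [eq_smul_add_smul hab (ρ • Q)]
  simp only [Matrix.transpose_add, Matrix.transpose_smul, Matrix.mul_add,
    Matrix.add_mul, Matrix.mul_smul, Matrix.smul_mul]
  module

theorem lmiC_smul_add_smul (H : Matrix (Fin q) (Fin r) ℝ) (J : Matrix (Fin q) (Fin m) ℝ)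
    (C : Matrix (Fin n) (Fin r) ℝ) (B : Matrix (Fin n) (Fin m) ℝ)
    (Q Q' : Matrix (Fin r) (Fin r) ℝ) (W W' : Matrix (Fin m) (Fin r) ℝ) (κ κ' : ℝ)
    {a b : ℝ} (hab : a + b = 1) :
    lmiC α ρ H J C B (a • Q + b • Q') (a • W + b • W') (a • κ + b • κ') =
      a • lmiC α ρ H J C B Q W κ + b • lmiC α ρ H J C B Q' W' κ' := by
  have e : ∀ {k : ℕ} (H : Matrix (Fin k) (Fin r) ℝ) (J : Matrix (Fin k) (Fin m) ℝ),
      H * (a • Q + b • Q') + J * (a • W + b • W') =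
      a • (H * Q + J * W) + b • (H * Q' + J * W') := by
    intro k H J
    simp only [Matrix.mul_add, Matrix.mul_smul]; module
  rw [lmiC, lmiC, lmiC, ← fromBlocks_smul_add_smul, e, e, fromCols_smul_add_smul,
    ← fromBlocks_smul_add_smul, ← eq_smul_add_smul hab]
  congr 2
  · module
  · module

theorem lmiC_plant_smul_add_smul (H : Matrix (Fin q) (Fin r) ℝ) (J : Matrix (Fin q) (Fin m) ℝ)
    (C C' : Matrix (Fin n) (Fin r) ℝ) (B B' : Matrix (Fin n) (Fin m) ℝ)
    (Q : Matrix (Fin r) (Fin r) ℝ) (W : Matrix (Fin m) (Fin r) ℝ) (κ : ℝ)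
    {a b : ℝ} (hab : a + b = 1) :
    lmiC α ρ H J (a • C + b • C') (a • B + b • B') Q W κ =
      a • lmiC α ρ H J C B Q W κ + b • lmiC α ρ H J C' B' Q W κ := by
  have e : (a • C + b • C') * Q + (a • B + b • B') * W =
      a • (C * Q + B * W) + b • (C' * Q + B' * W) := by
    simp only [Matrix.add_mul, Matrix.smul_mul]; module
  rw [lmiC, lmiC, lmiC, ← fromBlocks_smul_add_smul, e, ← eq_smul_add_smul hab,
    ← fromBlocks_smul_add_smul, ← eq_smul_add_smul hab, ← eq_smul_add_smul hab,
    ← eq_smul_add_smul hab]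

theorem bordered_smul_add_smul {ι : Type*} (θ θ' : ℝ) (v : ι → ℝ) (M M' : Matrix ι ι ℝ)
    {a b : ℝ} (hab : a + b = 1) :
    bordered (a • θ + b • θ') v (a • M + b • M') = a • bordered θ v M + b • bordered θ' v M' := by
  have e : ∀ (θ : ℝ) (M : Matrix ι ι ℝ), bordered θ v M = Matrix.fromBlocks
      (Matrix.of fun _ _ => θ) (Matrix.replicateCol Unit v)ᵀ (Matrix.replicateCol Unit v) M := by
    intro θ M
    rw [bordered, Matrix.transpose_replicateCol]
  rw [e, e, e, ← fromBlocks_smul_add_smul, ← eq_smul_add_smul hab]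
  rfl

variable {γ α ρ} in
theorem mem_feasibleSet_iff {N : ℕ}
    {A : Fin N → Matrix (Fin r) (Fin r) ℝ} {E : Fin N → Matrix (Fin r) (Fin n) ℝ}
    {C : Fin N → Matrix (Fin n) (Fin r) ℝ} {D : Fin N → Matrix (Fin n) (Fin n) ℝ}
    {B : Fin N → Matrix (Fin n) (Fin m) ℝ}
    {H : Matrix (Fin q) (Fin r) ℝ} {J : Matrix (Fin q) (Fin m) ℝ}
    {ζ₀ : EuclideanSpace ℝ (Fin r)} {σ₀ z₀ : EuclideanSpace ℝ (Fin n)} {θ : ℝ}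
    {Q : Matrix (Fin r) (Fin r) ℝ} {X : Matrix (Fin n ⊕ Fin n) (Fin n ⊕ Fin n) ℝ}
    {Y : Matrix (Fin m) (Fin n ⊕ Fin n) ℝ} {W : Matrix (Fin m) (Fin r) ℝ} {z : Fin 4 → ℝ} :
    (θ, Q, X, Y, W, z) ∈ feasibleSet γ α ρ A E C D B H J ζ₀ σ₀ z₀ ↔
      (∀ i, (-lmiN γ α ρ (D i) (B i) X Y z).PosDef) ∧
      (∀ i, (-lmiL α ρ H J (A i) (E i) Q X W).PosDef) ∧
      (∀ i, (lmiC α ρ H J (C i) (B i) Q W (z 3)).PosDef) ∧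
      (bordered θ (fun i => ζ₀ i) Q).PosDef ∧
      (bordered θ (Rx α σ₀ z₀) X).PosDef :=
  Iff.rfl

theorem convex_feasibleSet {N : ℕ}
    (A : Fin N → Matrix (Fin r) (Fin r) ℝ) (E : Fin N → Matrix (Fin r) (Fin n) ℝ)
    (C : Fin N → Matrix (Fin n) (Fin r) ℝ) (D : Fin N → Matrix (Fin n) (Fin n) ℝ)
    (B : Fin N → Matrix (Fin n) (Fin m) ℝ)
    (H : Matrix (Fin q) (Fin r) ℝ) (J : Matrix (Fin q) (Fin m) ℝ)
    (ζ₀ : EuclideanSpace ℝ (Fin r)) (σ₀ z₀ : EuclideanSpace ℝ (Fin n)) :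
    Convex ℝ (feasibleSet γ α ρ A E C D B H J ζ₀ σ₀ z₀) := by
  rintro ⟨θ, Q, X, Y, W, z⟩ h ⟨θ', Q', X', Y', W', z'⟩ k a b ha hb hab
  obtain ⟨h1, h2, h3, h4, h5⟩ := mem_feasibleSet_iff.1 h
  obtain ⟨k1, k2, k3, k4, k5⟩ := mem_feasibleSet_iff.1 k
  simp only [Prod.smul_mk, Prod.mk_add_mk]
  refine mem_feasibleSet_iff.2 ⟨fun i => ?_, fun i => ?_, fun i => ?_, ?_, ?_⟩
  · have := PosDef.smul_add_smul (h1 i) (k1 i) ha hb hab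
    rwa [smul_neg, smul_neg, ← neg_add, ← lmiN_smul_add_smul] at this
  · have := PosDef.smul_add_smul (h2 i) (k2 i) ha hb hab
    rwa [smul_neg, smul_neg, ← neg_add, ← lmiL_smul_add_smul _ _ _ _ _ _ _ _ _ _ _ _ hab] at this
  · have := PosDef.smul_add_smul (h3 i) (k3 i) ha hb hab
    rwa [← lmiC_smul_add_smul _ _ _ _ _ _ _ _ _ _ _ _ hab] at this
  · have := PosDef.smul_add_smul h4 k4 ha hb hab
    rwa [← bordered_smul_add_smul _ _ _ _ _ hab] at this
  · have := PosDef.smul_add_smul h5 k5 ha hb hab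
    rwa [← bordered_smul_add_smul _ _ _ _ _ hab] at this

/-- The vertex inequalities are affine in the plant, so they hold over the whole polytope. -/
theorem posDef_of_mem_polytope {N : ℕ}
    {A : Fin N → Matrix (Fin r) (Fin r) ℝ} {E : Fin N → Matrix (Fin r) (Fin n) ℝ}
    {C : Fin N → Matrix (Fin n) (Fin r) ℝ} {D : Fin N → Matrix (Fin n) (Fin n) ℝ}
    {B : Fin N → Matrix (Fin n) (Fin m) ℝ}
    {H : Matrix (Fin q) (Fin r) ℝ} {J : Matrix (Fin q) (Fin m) ℝ}
    {Q : Matrix (Fin r) (Fin r) ℝ} {X : Matrix (Fin n ⊕ Fin n) (Fin n ⊕ Fin n) ℝ}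
    {Y : Matrix (Fin m) (Fin n ⊕ Fin n) ℝ} {W : Matrix (Fin m) (Fin r) ℝ} {z : Fin 4 → ℝ}
    (h1 : ∀ i, (-lmiN γ α ρ (D i) (B i) X Y z).PosDef)
    (h2 : ∀ i, (-lmiL α ρ H J (A i) (E i) Q X W).PosDef)
    (h3 : ∀ i, (lmiC α ρ H J (C i) (B i) Q W (z 3)).PosDef)
    {A' : Matrix (Fin r) (Fin r) ℝ} {E' : Matrix (Fin r) (Fin n) ℝ}
    {C' : Matrix (Fin n) (Fin r) ℝ} {D' : Matrix (Fin n) (Fin n) ℝ}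
    {B' : Matrix (Fin n) (Fin m) ℝ} (h : (A', E', C', D', B') ∈ polytope A E C D B) :
    (-lmiN γ α ρ D' B' X Y z).PosDef ∧ (-lmiL α ρ H J A' E' Q X W).PosDef ∧
      (lmiC α ρ H J C' B' Q W (z 3)).PosDef := by
  have hconv : Convex ℝ {p : Matrix (Fin r) (Fin r) ℝ × Matrix (Fin r) (Fin n) ℝ ×
      Matrix (Fin n) (Fin r) ℝ × Matrix (Fin n) (Fin n) ℝ × Matrix (Fin n) (Fin m) ℝ |
      (-lmiN γ α ρ p.2.2.2.1 p.2.2.2.2 X Y z).PosDef ∧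
      (-lmiL α ρ H J p.1 p.2.1 Q X W).PosDef ∧
      (lmiC α ρ H J p.2.2.1 p.2.2.2.2 Q W (z 3)).PosDef} := by
    rintro ⟨A₁, E₁, C₁, D₁, B₁⟩ hp ⟨A₂, E₂, C₂, D₂, B₂⟩ hp' a b ha hb hab
    rw [mem_ofPred_eq] at hp hp' ⊢
    simp only [Prod.smul_mk, Prod.mk_add_mk] at hp hp' ⊢
    refine ⟨?_, ?_, ?_⟩
    · rw [lmiN_plant_smul_add_smul _ _ _ _ _ _ _ _ _ _ hab, neg_add, ← smul_neg, ← smul_neg]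
      exact PosDef.smul_add_smul hp.1 hp'.1 ha hb hab
    · rw [lmiL_plant_smul_add_smul _ _ _ _ _ _ _ _ _ _ _ hab, neg_add, ← smul_neg, ← smul_neg]
      exact PosDef.smul_add_smul hp.2.1 hp'.2.1 ha hb hab
    · rw [lmiC_plant_smul_add_smul _ _ _ _ _ _ _ _ _ _ _ hab]
      exact PosDef.smul_add_smul hp.2.2 hp'.2.2 ha hb hab
  have hmem := convexHull_min (range_subset_iff.2 fun i => ?_) hconv h
  · exact hmem
  · rw [mem_ofPred_eq]
    exact ⟨h1 i, h2 i, h3 i⟩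

end Convexity

/-! ### The certificate of a feasible point -/

section Construction

/-- The matrix-vector product between Euclidean spaces as a continuous linear map. -/
def actL {k l : ℕ} (M : Matrix (Fin k) (Fin l) ℝ) :
    EuclideanSpace ℝ (Fin l) →L[ℝ] EuclideanSpace ℝ (Fin k) :=
  LinearMap.toContinuousLinearMap
    { toFun := act M
      map_add' := fun u v => by simp [act, Matrix.mulVec_add]
      map_smul' := fun a v => by simp [act, Matrix.mulVec_smul] }

@[simp]
theorem actL_apply {k l : ℕ} (M : Matrix (Fin k) (Fin l) ℝ) (v : EuclideanSpace ℝ (Fin l)) :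
    actL M v = act M v := rfl

/-- The coordinates of a pair of vectors, as one vector. -/
def vec {n : ℕ} : EuclideanSpace ℝ (Fin n) × EuclideanSpace ℝ (Fin n) →ₗ[ℝ] Fin n ⊕ Fin n → ℝ where
  toFun y := Sum.elim y.1.ofLp y.2.ofLp
  map_add' u v := by ext (i | i) <;> simp
  map_smul' a v := by ext (i | i) <;> simp

theorem vec_apply {n : ℕ} (y : EuclideanSpace ℝ (Fin n) × EuclideanSpace ℝ (Fin n)) :
    vec y = Sum.elim y.1.ofLp y.2.ofLp := rfl

theorem vec_chi {n : ℕ} (α : ℝ) (σ z : EuclideanSpace ℝ (Fin n)) : vec (chi α σ z) = Rx α σ z := by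
  ext (i | i) <;> simp [vec_apply, chi, Rx]

theorem dotProduct_ofLp_self {k : ℕ} (v : EuclideanSpace ℝ (Fin k)) :
    v.ofLp ⬝ᵥ v.ofLp = ‖v‖ ^ 2 := by
  rw [EuclideanSpace.real_norm_sq_eq, dotProduct]
  simp only [pow_two]

/-- The bilinear form of a matrix, pulled back along a linear map. -/
def bilinOfMatrix {V ι : Type*} [NormedAddCommGroup V] [NormedSpace ℝ V] [FiniteDimensional ℝ V]
    [Fintype ι] [DecidableEq ι] (M : Matrix ι ι ℝ) (g : V →ₗ[ℝ] ι → ℝ) : V →L[ℝ] V →L[ℝ] ℝ :=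
  ((Matrix.toLinearMap₂' ℝ M).compl₁₂ g g).toContinuousBilinearMap

theorem bilinOfMatrix_apply {V ι : Type*} [NormedAddCommGroup V] [NormedSpace ℝ V]
    [FiniteDimensional ℝ V] [Fintype ι] [DecidableEq ι] (M : Matrix ι ι ℝ) (g : V →ₗ[ℝ] ι → ℝ)
    (u v : V) : bilinOfMatrix M g u v = g u ⬝ᵥ M *ᵥ g v := by
  simp [bilinOfMatrix, Matrix.toLinearMap₂'_apply']

theorem bilinOfMatrix_symm {V ι : Type*} [NormedAddCommGroup V] [NormedSpace ℝ V]
    [FiniteDimensional ℝ V] [Fintype ι] [DecidableEq ι] {M : Matrix ι ι ℝ} (hM : Mᵀ = M)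
    (g : V →ₗ[ℝ] ι → ℝ) (u v : V) : bilinOfMatrix M g u v = bilinOfMatrix M g v u := by
  rw [bilinOfMatrix_apply, bilinOfMatrix_apply, ← Matrix.dotProduct_transpose_mulVec, hM]

variable {r n m q : ℕ} {γ α ρ : ℝ}

/-- `P` is a certificate of the closed loop of the plant `(A, E, C, D, B)` under the gains `K₀`
and `K`, in the coordinates where the equilibrium is the origin. -/
structure Certificate.IsFor {O : Type*} [NormedAddCommGroup O] [NormedSpace ℝ O]
    (P : Certificate (EuclideanSpace ℝ (Fin r)) O n γ α) (A : Matrix (Fin r) (Fin r) ℝ)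
    (E : Matrix (Fin r) (Fin n) ℝ) (C : Matrix (Fin n) (Fin r) ℝ) (D : Matrix (Fin n) (Fin n) ℝ)
    (B : Matrix (Fin n) (Fin m) ℝ) (K₀ : Matrix (Fin m) (Fin r) ℝ)
    (K : Matrix (Fin m) (Fin n ⊕ Fin n) ℝ) : Prop where
  a_eq : P.a = actL A
  e_eq : P.e = actL E
  m_eq : P.m = actL (C + B * K₀)
  d_eq : P.d = actL D
  k_eq : P.k = (actL (B * K.toCols₁)).comp (ContinuousLinearMap.fst ℝ _ _) +
    (actL (B * K.toCols₂)).comp (ContinuousLinearMap.snd ℝ _ _)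

theorem mul_mulVec_inv_mulVec {ι κ : Type*} [Fintype ι] [Fintype κ] [DecidableEq ι]
    [DecidableEq κ] {Q : Matrix ι ι ℝ} (hQ : IsUnit Q.det) {p : Type*} [Fintype p]
    (C : Matrix κ ι ℝ) (B : Matrix κ p ℝ) (W : Matrix p ι ℝ) (v : ι → ℝ) :
    (C * Q + B * W) *ᵥ Q⁻¹ *ᵥ v = (C + B * (W * Q⁻¹)) *ᵥ v := by
  rw [Matrix.mulVec_mulVec, Matrix.add_mul, Matrix.mul_assoc C, Matrix.mul_nonsing_inv _ hQ,
    Matrix.mul_one, Matrix.mul_assoc]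

/-- A feasible point certifies the closed loop of every plant at which the three matrix
inequalities hold; the two quadratic forms are given by `Q⁻¹` and `X⁻¹`. -/
theorem exists_certificate (hγ : 0 < γ) (hα : 0 < α) (hρ : 0 < ρ)
    {H : Matrix (Fin q) (Fin r) ℝ} {J : Matrix (Fin q) (Fin m) ℝ}
    {Q : Matrix (Fin r) (Fin r) ℝ} {X : Matrix (Fin n ⊕ Fin n) (Fin n ⊕ Fin n) ℝ}
    {Y : Matrix (Fin m) (Fin n ⊕ Fin n) ℝ} {W : Matrix (Fin m) (Fin r) ℝ} {z : Fin 4 → ℝ}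
    {A : Matrix (Fin r) (Fin r) ℝ} {E : Matrix (Fin r) (Fin n) ℝ}
    {C : Matrix (Fin n) (Fin r) ℝ} {D : Matrix (Fin n) (Fin n) ℝ}
    {B : Matrix (Fin n) (Fin m) ℝ} (hQ : Q.PosDef) (hX : X.PosDef)
    (hN : (-lmiN γ α ρ D B X Y z).PosDef) (hL : (-lmiL α ρ H J A E Q X W).PosDef)
    (hC : (lmiC α ρ H J C B Q W (z 3)).PosDef) :
    ∃ P : Certificate (EuclideanSpace ℝ (Fin r)) (EuclideanSpace ℝ (Fin q)) n γ α,
      P.IsFor A E C D B (W * Q⁻¹) (Y * X⁻¹) ∧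
      P.h = actL (H + J * (W * Q⁻¹)) ∧ (∀ ζ, P.bz ζ ζ = ζ.ofLp ⬝ᵥ Q⁻¹ *ᵥ ζ.ofLp) ∧
      ∀ y, P.bx y y = vec y ⬝ᵥ X⁻¹ *ᵥ vec y := by
  -- for `n = 0` the weights do not enter the inequalities
  obtain ⟨z', hz', hN, hC⟩ : ∃ z' : Fin 4 → ℝ, (∀ j, 0 < z' j) ∧
      (-lmiN γ α ρ D B X Y z').PosDef ∧ (lmiC α ρ H J C B Q W (z' 3)).PosDef := by
    rcases n.eq_zero_or_pos with hn | hn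
    · subst hn
      refine ⟨fun _ => 1, fun _ => one_pos, ?_, ?_⟩
      · have : lmiN γ α ρ D B X Y (fun _ => 1) = lmiN γ α ρ D B X Y z := Subsingleton.elim _ _
        rwa [this]
      · have : ((1 : ℝ) • 1 : Matrix (Fin 0) (Fin 0) ℝ) = z 3 • 1 := Subsingleton.elim _ _
        rw [lmiC, this]
        exact hC
    · exact ⟨z, Zd_pos hN ⟨0, hn⟩, hN, hC⟩
  have hQd : IsUnit Q.det := (Matrix.isUnit_iff_isUnit_det _).1 hQ.isUnit
  have hXd : IsUnit X.det := (Matrix.isUnit_iff_isUnit_det _).1 hX.isUnit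
  have hQt : Qᵀ = Q := by simpa using hQ.isHermitian.eq
  have hXt : Xᵀ = X := by simpa using hX.isHermitian.eq
  have hQit : (Q⁻¹)ᵀ = Q⁻¹ := by rw [Matrix.transpose_nonsing_inv, hQt]
  have hXit : (X⁻¹)ᵀ = X⁻¹ := by rw [Matrix.transpose_nonsing_inv, hXt]
  obtain ⟨εN, hεN, dN⟩ := exists_lmiN_dissipation hXt hz' hN
  obtain ⟨εL, hεL, dL⟩ := exists_lmiL_dissipation hQt hXt hL
  have dC := lmiC_le hα (hz' 3) hC
  obtain ⟨c₁, hc₁, coQ⟩ := PosDef.exists_mul_le hQ.inv 1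
  obtain ⟨c₂, hc₂, coX⟩ := PosDef.exists_mul_le hX.inv 1
  set g : EuclideanSpace ℝ (Fin r) →ₗ[ℝ] (Fin r → ℝ) :=
    (WithLp.linearEquiv 2 ℝ (Fin r → ℝ)).toLinearMap with hg
  have hgv : ∀ v, g v = v.ofLp := fun _ => rfl
  have bz_coercive : ∀ u, c₁ * ‖u‖ ^ 2 ≤ bilinOfMatrix Q⁻¹ g u u := by
    intro u
    have := coQ u.ofLp
    rwa [Matrix.one_mulVec, dotProduct_ofLp_self, ← hgv, ← bilinOfMatrix_apply] at this
  have bx_coercive : ∀ u, c₂ * ‖u‖ ^ 2 ≤ bilinOfMatrix X⁻¹ vec u u := by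
    intro u
    have := coX (vec u)
    rw [Matrix.one_mulVec, vec_apply, sumElim_dotProduct_sumElim, dotProduct_ofLp_self,
      dotProduct_ofLp_self] at this
    rw [bilinOfMatrix_apply]
    refine le_trans ?_ this
    gcongr
    rw [Prod.norm_def]
    rcases max_cases ‖u.1‖ ‖u.2‖ with ⟨h, _⟩ | ⟨h, _⟩ <;> rw [h] <;>
      nlinarith [sq_nonneg ‖u.1‖, sq_nonneg ‖u.2‖]
  set k : EuclideanSpace ℝ (Fin n) × EuclideanSpace ℝ (Fin n) →L[ℝ] EuclideanSpace ℝ (Fin n) :=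
    (actL (B * (Y * X⁻¹).toCols₁)).comp (ContinuousLinearMap.fst ℝ _ _) +
      (actL (B * (Y * X⁻¹).toCols₂)).comp (ContinuousLinearMap.snd ℝ _ _) with hk
  have hkv : ∀ χ, (k χ).ofLp = B *ᵥ Y *ᵥ X⁻¹ *ᵥ vec χ := by
    intro χ
    have h1 : Y *ᵥ X⁻¹ *ᵥ vec χ =
        (Y * X⁻¹).toCols₁ *ᵥ χ.1.ofLp + (Y * X⁻¹).toCols₂ *ᵥ χ.2.ofLp := by
      rw [Matrix.mulVec_mulVec, vec_apply, ← Matrix.fromCols_mulVec_sumElim,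
        Matrix.fromCols_toCols]
    rw [h1, Matrix.mulVec_add, Matrix.mulVec_mulVec, Matrix.mulVec_mulVec]
    simp [hk, act]
  have hQQ : ∀ v, Q *ᵥ Q⁻¹ *ᵥ v = v := fun v => by
    rw [Matrix.mulVec_mulVec, Matrix.mul_nonsing_inv _ hQd, Matrix.one_mulVec]
  have hXX : ∀ v, X *ᵥ X⁻¹ *ᵥ v = v := fun v => by
    rw [Matrix.mulVec_mulVec, Matrix.mul_nonsing_inv _ hXd, Matrix.one_mulVec]
  have hnorm : ∀ (M : Matrix (Fin q) (Fin r) ℝ) (ζ : EuclideanSpace ℝ (Fin r)),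
      M *ᵥ ζ.ofLp ⬝ᵥ M *ᵥ ζ.ofLp = ‖actL M ζ‖ ^ 2 := fun M ζ => by
    rw [← dotProduct_ofLp_self]; rfl
  have hnorm' : ∀ (M : Matrix (Fin n) (Fin r) ℝ) (ζ : EuclideanSpace ℝ (Fin r)),
      M *ᵥ ζ.ofLp ⬝ᵥ M *ᵥ ζ.ofLp = ‖actL M ζ‖ ^ 2 := fun M ζ => by
    rw [← dotProduct_ofLp_self]; rfl
  have hsq : ∀ {x y : ℝ}, 0 ≤ x → x ≤ y → x ^ 2 ≤ y ^ 2 := fun hx hxy => by gcongr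
  refine ⟨{ a := actL A, e := actL E, m := actL (C + B * (W * Q⁻¹)), d := actL D, k := k
            h := actL (H + J * (W * Q⁻¹))
            bz := bilinOfMatrix Q⁻¹ g
            bx := bilinOfMatrix X⁻¹ vec
            ω := min εL (α * εN), c₀ := min c₁ c₂, α_pos := hα, γ_pos := hγ
            ω_pos := lt_min hεL (mul_pos hα hεN), c₀_pos := lt_min hc₁ hc₂
            bz_symm := bilinOfMatrix_symm hQit g
            bx_symm := bilinOfMatrix_symm hXit vec
            bz_coercive := fun u => le_trans (by gcongr; exact min_le_left _ _) (bz_coercive u)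
            bx_coercive := fun u => le_trans (by gcongr; exact min_le_right _ _) (bx_coercive u)
            linear_decay := ?_
            nonlinear_decay := ?_ }, ⟨rfl, rfl, rfl, rfl, rfl⟩, rfl, ?_, ?_⟩
  · intro ζ χ hle
    have hV : 0 ≤ bilinOfMatrix Q⁻¹ g ζ ζ :=
      (mul_nonneg hc₁.le (sq_nonneg _)).trans (bz_coercive ζ)
    have h1 := dL (Q⁻¹ *ᵥ ζ.ofLp) (X⁻¹ *ᵥ vec χ) χ.1.ofLp χ.2.ofLp (hXX _)
    rw [hXX, hQQ, mul_mulVec_inv_mulVec hQd, hnorm, dotProduct_comm _ (vec χ),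
      ← bilinOfMatrix_apply X⁻¹ vec χ χ] at h1
    have h2 : bilinOfMatrix Q⁻¹ g ζ (actL A ζ + actL E (α⁻¹ • χ.1)) =
        Q⁻¹ *ᵥ ζ.ofLp ⬝ᵥ (A *ᵥ ζ.ofLp + α⁻¹ • E *ᵥ χ.1.ofLp) := by
      rw [bilinOfMatrix_symm hQit, bilinOfMatrix_apply, dotProduct_comm, map_smul]
      rfl
    have h3 : Q⁻¹ *ᵥ ζ.ofLp ⬝ᵥ ζ.ofLp = bilinOfMatrix Q⁻¹ g ζ ζ := by
      rw [bilinOfMatrix_apply, dotProduct_comm, hgv]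
    rw [h3] at h1
    rw [h2]
    have h4 : min εL (α * εN) * bilinOfMatrix Q⁻¹ g ζ ζ ≤ εL * bilinOfMatrix Q⁻¹ g ζ ζ := by
      gcongr; exact min_le_left _ _
    have h5 := mul_le_mul_of_nonneg_left hle hρ.le
    linarith
  · intro ζ χ w₁ w₂ w₃ w₄ h1 h2 h3 h4 hle
    have hV : 0 ≤ bilinOfMatrix X⁻¹ vec χ χ :=
      (mul_nonneg hc₂.le (sq_nonneg _)).trans (bx_coercive χ)
    set u := X⁻¹ *ᵥ vec χ with hu
    have hue : Sum.elim (u ∘ Sum.inl) (u ∘ Sum.inr) = u := Sum.elim_comp_inl_inr u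
    have key := dN (u ∘ Sum.inl) (u ∘ Sum.inr) χ.1.ofLp χ.2.ofLp w₁.ofLp w₂.ofLp w₃.ofLp w₄.ofLp
      (by rw [hue]; exact hXX _)
      (by
        rw [hue, ← hkv χ, dotProduct_ofLp_self, dotProduct_ofLp_self]
        exact hsq (norm_nonneg _) h1)
      (by
        rw [dotProduct_ofLp_self, dotProduct_ofLp_self, ← mul_pow]
        exact hsq (norm_nonneg _) h2)
      (by
        have e : (D *ᵥ χ.1.ofLp) ⬝ᵥ (D *ᵥ χ.1.ofLp) = ‖actL D χ.1‖ ^ 2 := by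
          rw [← dotProduct_ofLp_self]; rfl
        rw [e, dotProduct_ofLp_self, ← mul_pow]
        exact hsq (norm_nonneg _) h3)
    rw [hue, ← hkv χ, dotProduct_ofLp_self w₄, ← sumElim_dotProduct_sumElim,
      ← sumElim_dotProduct_sumElim, hue] at key
    have e1 : bilinOfMatrix X⁻¹ vec χ (k χ + (1 / 2 : ℝ) • w₁ + w₃ + w₄, χ.1 + w₂) =
        u ⬝ᵥ Sum.elim ((k χ).ofLp + (1 / 2 : ℝ) • w₁.ofLp + w₃.ofLp + w₄.ofLp)
          (χ.1.ofLp + w₂.ofLp) := by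
      rw [bilinOfMatrix_symm hXit, bilinOfMatrix_apply, dotProduct_comm]
      rfl
    have e2 : u ⬝ᵥ Sum.elim χ.1.ofLp χ.2.ofLp = bilinOfMatrix X⁻¹ vec χ χ := by
      rw [bilinOfMatrix_apply, dotProduct_comm]; rfl
    rw [e1]
    rw [e2] at key
    have h5 := dC (Q⁻¹ *ᵥ ζ.ofLp)
    rw [hQQ, mul_mulVec_inv_mulVec hQd, mul_mulVec_inv_mulVec hQd, hnorm, hnorm',
      dotProduct_comm _ ζ.ofLp, ← hgv ζ, ← bilinOfMatrix_apply] at h5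
    have h6 : (z' 3)⁻¹ * ‖w₄‖ ^ 2 ≤ (z' 3)⁻¹ * ‖actL (C + B * (W * Q⁻¹)) ζ‖ ^ 2 := by
      have := (hz' 3).le
      gcongr
    have h7 : min εL (α * εN) * bilinOfMatrix X⁻¹ vec χ χ ≤
        α * εN * bilinOfMatrix X⁻¹ vec χ χ := by
      gcongr; exact min_le_right _ _
    have h8 := mul_le_mul_of_nonneg_left hle hρ.le
    set y := 2 * (u ⬝ᵥ Sum.elim ((k χ).ofLp + (1 / 2 : ℝ) • w₁.ofLp + w₃.ofLp + w₄.ofLp)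
          (χ.1.ofLp + w₂.ofLp))
    set V := bilinOfMatrix X⁻¹ vec χ χ
    set ξ := ‖actL (H + J * (W * Q⁻¹)) ζ‖ ^ 2
    have h9 : y ≤ -(εN * V) - α⁻¹ * ξ := by linarith
    have h10 := mul_le_mul_of_nonneg_left h9 hα.le
    have h11 : α * (-(εN * V) - α⁻¹ * ξ) = -(α * εN * V) - ξ := by field_simp
    linarith
  · exact fun ζ => bilinOfMatrix_apply _ _ _ _
  · exact fun y => bilinOfMatrix_apply _ _ _ _

end Construction

/-! ### Filippov solutions of the closed loop -/

section FilippovMap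

variable {S T : Type*} [NormedAddCommGroup S] [NormedSpace ℝ S] [MeasureSpace S]
  [NormedAddCommGroup T] [NormedSpace ℝ T] {F : ℝ → S → S} {t : ℝ} {x v : S}

theorem mem_of_mem_filippovMap {K : Set S} (hK : Convex ℝ K) (hKc : IsClosed K)
    (h : ∀ᶠ y in 𝓝 x, F t y ∈ K) (hv : v ∈ filippovMap F t x) : v ∈ K := by
  obtain ⟨ε, hε, hball⟩ := Metric.eventually_nhds_iff_ball.1 h
  simp only [filippovMap, mem_iInter] at hv
  refine closure_minimal (convexHull_min ?_ hK) hKc (hv ε hε ∅ measure_empty)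
  rintro _ ⟨y, hy, rfl⟩
  exact hball y hy.1

/-- Where a component of the vector field is continuous, it is not changed by Filippov's
regularization. -/
theorem eq_of_mem_filippovMap (L : S →L[ℝ] T) (h : ContinuousAt (fun y => L (F t y)) x)
    (hv : v ∈ filippovMap F t x) : L v = L (F t x) := by
  rw [← sub_eq_zero, ← norm_le_zero_iff]
  refine le_of_forall_pos_le_add fun η hη => ?_
  have := mem_of_mem_filippovMap (K := L ⁻¹' Metric.closedBall (L (F t x)) η)
    ((convex_closedBall _ _).is_linear_preimage L.toLinearMap.isLinear)
    (Metric.isClosed_closedBall.preimage L.continuous)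
    (h.eventually_mem (Metric.closedBall_mem_nhds _ hη)) hv
  rw [mem_preimage, mem_closedBall_iff_norm] at this
  linarith

theorem norm_le_of_mem_filippovMap (L : S →L[ℝ] T) {R : S → ℝ} (hR : ContinuousAt R x)
    (h : ∀ y, ‖L (F t y)‖ ≤ R y) (hv : v ∈ filippovMap F t x) : ‖L v‖ ≤ R x := by
  refine le_of_forall_pos_le_add fun η hη => ?_
  have := mem_of_mem_filippovMap (K := L ⁻¹' Metric.closedBall 0 (R x + η))
    ((convex_closedBall _ _).is_linear_preimage L.toLinearMap.isLinear)
    (Metric.isClosed_closedBall.preimage L.continuous)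
    ((hR.eventually_lt_const (lt_add_of_pos_right _ hη)).mono fun y hy => by
      rw [mem_preimage, mem_closedBall_zero_iff]
      exact (h y).trans hy.le) hv
  rwa [mem_preimage, mem_closedBall_zero_iff] at this

end FilippovMap

section ClosedLoop

variable {r n m : ℕ} {γ α : ℝ} {O : Type*} [NormedAddCommGroup O] [NormedSpace ℝ O]
  {P : Certificate (EuclideanSpace ℝ (Fin r)) O n γ α} {A : Matrix (Fin r) (Fin r) ℝ}
  {E : Matrix (Fin r) (Fin n) ℝ} {C : Matrix (Fin n) (Fin r) ℝ} {D : Matrix (Fin n) (Fin n) ℝ}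
  {B : Matrix (Fin n) (Fin m) ℝ} {K₀ : Matrix (Fin m) (Fin r) ℝ}
  {K : Matrix (Fin m) (Fin n ⊕ Fin n) ℝ} {f : ℝ → EuclideanSpace ℝ (Fin n)}

theorem Certificate.IsFor.k_apply (hP : P.IsFor A E C D B K₀ K)
    (y : EuclideanSpace ℝ (Fin n) × EuclideanSpace ℝ (Fin n)) :
    P.k y = act (B * K.toCols₁) y.1 + act (B * K.toCols₂) y.2 := by
  rw [hP.k_eq]; rfl

/-- `B K₂` is invertible: the equilibrium equation `B K₂ z = 0` has only the trivial solution. -/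
theorem Certificate.IsFor.isUnit_det (hP : P.IsFor A E C D B K₀ K) :
    IsUnit (B * K.toCols₂).det := by
  rw [← Matrix.isUnit_iff_isUnit_det, ← Matrix.mulVec_injective_iff_isUnit]
  intro u v huv
  have h1 : P.m 0 + P.k (0, WithLp.toLp 2 (u - v)) = 0 := by
    rw [map_zero, zero_add, hP.k_apply]
    simp only [act, Matrix.mulVec_sub]
    rw [huv]
    simp
  have h2 := Certificate.eq_zero_of_sliding h1 (by
    rw [map_zero]
    exact (mul_nonneg P.c₀_pos.le (sq_nonneg _)).trans (P.bx_coercive _))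
  have h3 : u - v = 0 := congrArg WithLp.ofLp h2.2
  exact sub_eq_zero.1 h3

theorem closedLoop_fst (hP : P.IsFor A E C D B K₀ K) (t : ℝ) (s : State r n) :
    (closedLoop α A E C D B K₀ K f t s).1 = P.a s.1 + P.e s.2.1 := by
  rw [hP.a_eq, hP.e_eq]; rfl

theorem closedLoop_snd_fst (hP : P.IsFor A E C D B K₀ K) (t : ℝ) (s : State r n) :
    (closedLoop α A E C D B K₀ K f t s).2.1 =
      P.m s.1 + P.d s.2.1 + P.k (chi α s.2.1 s.2.2) + f t := by
  rw [hP.m_eq, hP.d_eq, hP.k_apply]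
  apply WithLp.ofLp_injective
  simp only [closedLoop, control, act, actL_apply, chi, WithLp.ofLp_add, WithLp.ofLp_smul,
    Matrix.mulVec_add, Matrix.mulVec_smul, Matrix.add_mulVec, Matrix.mulVec_mulVec]
  abel

/-- The velocities allowed by Filippov's regularization of the closed loop. Only the last
component is discontinuous, and only at `σ = 0`, where it remains bounded. -/
theorem of_mem_filippovMap_closedLoop (hP : P.IsFor A E C D B K₀ K) {t : ℝ} {s v : State r n}
    (hv : v ∈ filippovMap (closedLoop α A E C D B K₀ K f) t s) :
    v.1 = P.a s.1 + P.e s.2.1 ∧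
    v.2.1 = P.m s.1 + P.d s.2.1 + P.k (chi α s.2.1 s.2.2) + f t ∧
    ‖v.2.2‖ ≤ (1 + α * √‖s.2.1‖) ^ 2 ∧ (s.2.1 ≠ 0 → v.2.2 = c α s.2.1 ^ 2 • s.2.1) := by
  have hα := P.α_pos
  let L₃ : State r n →L[ℝ] EuclideanSpace ℝ (Fin n) :=
    (ContinuousLinearMap.snd ℝ _ _).comp (ContinuousLinearMap.snd ℝ _ _)
  have h1 := eq_of_mem_filippovMap
    (ContinuousLinearMap.fst ℝ _ _ : State r n →L[ℝ] EuclideanSpace ℝ (Fin r)) (by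
    simp only [ContinuousLinearMap.coe_fst', closedLoop_fst hP]
    fun_prop) hv
  have h2 := eq_of_mem_filippovMap
    ((ContinuousLinearMap.fst ℝ _ _).comp (ContinuousLinearMap.snd ℝ _ _) :
      State r n →L[ℝ] EuclideanSpace ℝ (Fin n)) (by
    simp only [ContinuousLinearMap.comp_apply, ContinuousLinearMap.coe_fst',
      ContinuousLinearMap.coe_snd', closedLoop_snd_fst hP]
    have hχ : Continuous fun s : State r n => chi α s.2.1 s.2.2 :=
      ((continuous_c_smul hα).comp (by fun_prop)).prodMk (by fun_prop)
    fun_prop) hv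
  have h3 := norm_le_of_mem_filippovMap L₃ (R := fun s : State r n => (1 + α * √‖s.2.1‖) ^ 2)
    (by fun_prop) (fun y => by
      change ‖c α y.2.1 ^ 2 • y.2.1‖ ≤ _
      by_cases hy : y.2.1 = 0
      · rw [hy, smul_zero, norm_zero]; positivity
      · rw [norm_c_sq_smul hα hy]) hv
  refine ⟨h1.trans (closedLoop_fst (f := f) hP t s), h2.trans (closedLoop_snd_fst hP t s), h3,
    fun hσ => ?_⟩
  have hs : √‖s.2.1‖ ≠ 0 := (Real.sqrt_pos.2 (norm_pos_iff.2 hσ)).ne'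
  refine eq_of_mem_filippovMap L₃ ?_ hv
  change ContinuousAt (fun y : State r n => (1 / √‖y.2.1‖ + α) ^ 2 • y.2.1) s
  fun_prop (disch := exact hs)

theorem norm_act_le {k : ℕ} (M : Matrix (Fin k) (Fin k) ℝ) (v : EuclideanSpace ℝ (Fin k)) :
    ‖act M v‖ ≤ maxSingularValue M * ‖v‖ :=
  (Matrix.toEuclideanCLM (𝕜 := ℝ) M).le_opNorm v

/-- In the shifted coordinates, Filippov solutions under admissible disturbances are trajectories
of the certified system. -/
theorem isTrajectory_of_isFilippovSolution (hP : P.IsFor A E C D B K₀ K)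
    (hf : IsDisturbance (disturbanceBound γ B K) f) {I : Set ℝ} {s : ℝ → State r n}
    (hs : IsFilippovSolution (closedLoop α A E C D B K₀ K f) I s) {b : ℝ} (hb : 0 < b)
    (hbI : Icc 0 b ⊆ I) :
    P.IsTrajectory b (fun t => (s t).1) (fun t => (s t).2.1)
      (fun t => (s t).2.2 + act (B * K.toCols₂)⁻¹ (f t)) := by
  obtain ⟨hfd, hfb⟩ := hf
  set M := (B * K.toCols₂)⁻¹ with hM
  have hα := P.α_pos
  have hγ : 0 ≤ γ⁻¹ := (inv_pos.2 P.γ_pos).le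
  have hδ : 0 ≤ disturbanceBound γ B K :=
    mul_nonneg (inv_nonneg.2 (norm_nonneg _)) hγ
  have hac := hs.absolutelyContinuous b (hbI (right_mem_Icc.2 hb.le))
  have hsc : ContinuousOn s (Icc 0 b) := by
    have := hac.continuousOn
    rwa [uIcc_of_le hb.le] at this
  have hfc : ContinuousOn f (Icc 0 b) := hfd.continuousOn.mono Icc_subset_Ici_self
  have hae : ∀ᵐ t, t ∈ Ioo 0 b → ∃ x', HasDerivAt s x' t ∧
      x' ∈ filippovMap (closedLoop α A E C D B K₀ K f) t (s t) :=
    (ae_restrict_iff' measurableSet_Ioo).1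
      (ae_restrict_of_ae_restrict_of_subset (Ioo_subset_Icc_self.trans hbI) hs.deriv_mem)
  -- the velocities are bounded on `[0, b]`
  have hbd : ContinuousOn (fun t => ‖P.a (s t).1 + P.e (s t).2.1‖ +
      ‖P.m (s t).1 + P.d (s t).2.1 + P.k (chi α (s t).2.1 (s t).2.2) + f t‖ +
      (1 + α * √‖(s t).2.1‖) ^ 2) (Icc 0 b) := by
    have hχ : Continuous fun s : State r n => chi α s.2.1 s.2.2 :=
      ((continuous_c_smul hα).comp (by fun_prop)).prodMk (by fun_prop)
    have hχs := hχ.comp_continuousOn hsc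
    simp only [Function.comp_def] at hχs
    fun_prop
  obtain ⟨R, hR⟩ := isCompact_Icc.exists_bound_of_continuousOn hbd
  have hR0 : 0 ≤ R := (norm_nonneg _).trans (hR 0 (left_mem_Icc.2 hb.le))
  have hlip := norm_sub_le_of_absolutelyContinuousOnInterval hR0 hac (by
    filter_upwards [hae] with t ht htb
    obtain ⟨x', hx', hmem⟩ := ht htb
    refine ⟨x', hx', ?_⟩
    obtain ⟨h1, h2, h3, -⟩ := of_mem_filippovMap_closedLoop hP hmem
    have h4 := (le_abs_self _).trans (hR t (Ioo_subset_Icc_self htb))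
    rw [← h1, ← h2] at h4
    have n1 := norm_nonneg x'.1
    have n2 := norm_nonneg x'.2.1
    have n3 := norm_nonneg x'.2.2
    rw [Prod.norm_def, Prod.norm_def]
    refine max_le ?_ (max_le ?_ ?_) <;> linarith [sq_nonneg (1 + α * √‖(s t).2.1‖)])
  have hflip : ∀ u ∈ Icc 0 b, ∀ t ∈ Icc 0 b, ‖f t - f u‖ ≤ disturbanceBound γ B K * |t - u| :=
    fun u hu t ht => (convex_Ici (0 : ℝ)).norm_image_sub_le_of_norm_derivWithin_le hfd
      (fun x hx => hfb x hx) hu.1 ht.1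
  refine ⟨⟨R, hR0, fun u hu t ht => (norm_fst_le (s t - s u)).trans (hlip u hu t ht)⟩,
    ⟨R, hR0, fun u hu t ht => (norm_fst_le (s t - s u).2).trans
      ((norm_snd_le (s t - s u)).trans (hlip u hu t ht))⟩,
    ⟨R + maxSingularValue M * disturbanceBound γ B K,
      add_nonneg hR0 (mul_nonneg (norm_nonneg _) hδ), fun u hu t ht => ?_⟩, ?_⟩
  · have e : (s t).2.2 + act M (f t) - ((s u).2.2 + act M (f u)) =
        (s t - s u).2.2 + act M (f t - f u) := by
      rw [← actL_apply, ← actL_apply, ← actL_apply, map_sub, Prod.snd_sub, Prod.snd_sub]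
      abel
    rw [e, add_mul]
    refine (norm_add_le _ _).trans (add_le_add ?_ ?_)
    · exact (norm_snd_le (s t - s u).2).trans
        ((norm_snd_le (s t - s u)).trans (hlip u hu t ht))
    · refine (norm_act_le M _).trans ?_
      rw [mul_assoc]
      exact mul_le_mul_of_nonneg_left (hflip u hu t ht) (norm_nonneg _)
  · filter_upwards [hae] with t ht htb
    obtain ⟨x', hx', hmem⟩ := ht htb
    obtain ⟨h1, h2, -, h4⟩ := of_mem_filippovMap_closedLoop hP hmem
    have d1 : HasDerivAt (fun t => (s t).1) x'.1 t := hx'.fst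
    have d2 : HasDerivAt (fun t => (s t).2.1) x'.2.1 t := hx'.snd.fst
    have d3 : HasDerivAt (fun t => (s t).2.2) x'.2.2 t := hx'.snd.snd
    refine ⟨d1.congr_deriv h1, d2.congr_deriv ?_, fun hσ => ?_⟩
    · -- `B K₂ z = B K₂ η + f`
      rw [h2, hP.k_apply, hP.k_apply]
      have e : act (B * K.toCols₂) (act M (f t)) = f t := by
        simp only [act, Matrix.mulVec_mulVec]
        rw [hM, Matrix.mul_nonsing_inv _ hP.isUnit_det, Matrix.one_mulVec]
      have e2 : act (B * K.toCols₂) ((s t).2.2 + act M (f t)) =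
          act (B * K.toCols₂) (s t).2.2 + f t := by
        rw [← actL_apply, map_add, actL_apply, actL_apply, e]
      simp only [chi]
      rw [e2]
      abel
    · refine ⟨act M (derivWithin f (Ici 0) t), ?_, ?_⟩
      · refine (norm_act_le M _).trans ?_
        calc maxSingularValue M * ‖derivWithin f (Ici 0) t‖
            ≤ maxSingularValue M * disturbanceBound γ B K :=
              mul_le_mul_of_nonneg_left (hfb t htb.1.le) (norm_nonneg _)
          _ = (maxSingularValue M * (maxSingularValue M)⁻¹) * γ⁻¹ := by
              rw [disturbanceBound, mul_assoc]
          _ ≤ 1 * γ⁻¹ := mul_le_mul_of_nonneg_right mul_inv_le_one hγ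
          _ = γ⁻¹ := one_mul _
      · have hft : HasDerivAt f (derivWithin f (Ici 0) t) t :=
          (hfd t htb.1.le).hasDerivWithinAt.hasDerivAt (Ici_mem_nhds htb.1)
        have := d3.add ((actL M).hasFDerivAt.comp_hasDerivAt t hft)
        rw [h4 hσ] at this
        exact this

theorem isGloballyAsymptoticallyStable_of_certificate (hP : P.IsFor A E C D B K₀ K)
    (hf : IsDisturbance (disturbanceBound γ B K) f) :
    IsGloballyAsymptoticallyStable (closedLoop α A E C D B K₀ K f) (shifted B K f) := by
  have hα := P.α_pos
  have hK : 0 < P.c₀ / (1 + α⁻¹) ^ 2 := by have := P.c₀_pos; positivity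
  have hle : ∀ (T : ℝ) (x : ℝ → State r n),
      IsFilippovSolution (closedLoop α A E C D B K₀ K f) (Ico 0 T) x → ∀ t ∈ Ico 0 T,
      P.c₀ / (1 + α⁻¹) ^ 2 * ‖shifted B K f t (x t)‖ ^ 2 ≤ P.energy (shifted B K f 0 (x 0)).1
        (shifted B K f 0 (x 0)).2.1 (shifted B K f 0 (x 0)).2.2 := by
    intro T x hx t ht
    refine (P.norm_sq_le_energy _ _ _).trans ?_
    rcases ht.1.eq_or_lt with rfl | h0
    · exact le_rfl
    · exact (isTrajectory_of_isFilippovSolution hP hf hx h0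
        (Icc_subset_Ico_right ht.2)).energy_le le_rfl h0.le le_rfl
  refine ⟨fun ε hε => ?_, fun T x hx => ?_, fun x hx => ?_⟩
  · have h0 : Tendsto (fun s : State r n => P.energy s.1 s.2.1 s.2.2) (𝓝 0) (𝓝 0) := by
      have := P.continuous_energy.tendsto 0
      simpa only [Prod.fst_zero, Prod.snd_zero, P.energy_zero] using this
    have hε' : 0 < P.c₀ / (1 + α⁻¹) ^ 2 * ε ^ 2 := by positivity
    obtain ⟨δ, hδ, hball⟩ := Metric.eventually_nhds_iff.1 (h0.eventually_lt_const hε')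
    refine ⟨δ, hδ, fun T x hx hx0 t ht => ?_⟩
    have h1 := (hle T x hx t ht).trans_lt
      (hball (y := shifted B K f 0 (x 0)) (by rwa [dist_zero_right]))
    exact lt_of_pow_lt_pow_left₀ 2 hε.le (lt_of_mul_lt_mul_left h1 hK.le)
  · set V := P.energy (shifted B K f 0 (x 0)).1 (shifted B K f 0 (x 0)).2.1
      (shifted B K f 0 (x 0)).2.2 with hV
    refine (Metric.isBounded_iff_subset_closedBall (0 : State r n)).2
      ⟨√(V / (P.c₀ / (1 + α⁻¹) ^ 2)), ?_⟩
    rintro _ ⟨t, ht, rfl⟩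
    rw [mem_closedBall_zero_iff]
    refine Real.le_sqrt_of_sq_le ?_
    rw [le_div_iff₀' hK]
    exact hle T x hx t ht
  · exact Certificate.tendsto_zero fun b hb =>
      isTrajectory_of_isFilippovSolution hP hf hx hb Icc_subset_Ici_self

end ClosedLoop

/-- The energy of the initial condition bounds the cost, and the bordered inequalities bound that
energy by `θ`. -/
theorem hasGuaranteedCost_of_certificate {r n m q : ℕ} {γ α : ℝ}
    {P : Certificate (EuclideanSpace ℝ (Fin r)) (EuclideanSpace ℝ (Fin q)) n γ α}
    {A : Matrix (Fin r) (Fin r) ℝ} {E : Matrix (Fin r) (Fin n) ℝ}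
    {C : Matrix (Fin n) (Fin r) ℝ} {D : Matrix (Fin n) (Fin n) ℝ}
    {B : Matrix (Fin n) (Fin m) ℝ} {K₀ : Matrix (Fin m) (Fin r) ℝ}
    {K : Matrix (Fin m) (Fin n ⊕ Fin n) ℝ} {f : ℝ → EuclideanSpace ℝ (Fin n)}
    (hP : P.IsFor A E C D B K₀ K) {H : Matrix (Fin q) (Fin r) ℝ} {J : Matrix (Fin q) (Fin m) ℝ}
    (hh : P.h = actL (H + J * K₀)) (hf : IsDisturbance (disturbanceBound γ B K) f)
    {ζ₀ : EuclideanSpace ℝ (Fin r)} {σ₀ z₀ : EuclideanSpace ℝ (Fin n)} {θ : ℝ}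
    (hθ : P.energy ζ₀ σ₀ z₀ ≤ θ) :
    HasGuaranteedCost (closedLoop α A E C D B K₀ K f) (shifted B K f) H J K₀ ζ₀ σ₀ z₀ θ := by
  intro s hs h0
  have h1 := Certificate.integral_output_le fun b hb =>
    isTrajectory_of_isFilippovSolution hP hf hs hb Icc_subset_Ici_self
  have e1 : (s 0).1 = ζ₀ := congrArg Prod.fst h0
  have e2 : (s 0).2.1 = σ₀ := congrArg (fun p => p.2.1) h0
  have e3 : (s 0).2.2 + act (B * K.toCols₂)⁻¹ (f 0) = z₀ := congrArg (fun p => p.2.2) h0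
  rw [hh] at h1
  refine ⟨h1.1, h1.2.trans ?_⟩
  rw [e1, e2, e3]
  exact hθ

end MGSTA

end

theorem mainTheorem4 {r n m q N : ℕ} (γ α ρ : ℝ) (hγ : 0 < γ) (hα : 0 < α) (hρ : 0 < ρ)
    (A : Fin N → Matrix (Fin r) (Fin r) ℝ) (E : Fin N → Matrix (Fin r) (Fin n) ℝ)
    (C : Fin N → Matrix (Fin n) (Fin r) ℝ) (D : Fin N → Matrix (Fin n) (Fin n) ℝ)
    (B : Fin N → Matrix (Fin n) (Fin m) ℝ)
    (H : Matrix (Fin q) (Fin r) ℝ) (J : Matrix (Fin q) (Fin m) ℝ)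
    (ζ₀ : EuclideanSpace ℝ (Fin r)) (σ₀ z₀ : EuclideanSpace ℝ (Fin n)) :
    -- the minimization of `θ` over the feasible set is a convex program
    Convex ℝ (MGSTA.feasibleSet γ α ρ A E C D B H J ζ₀ σ₀ z₀) ∧
    -- if it is feasible, its optimal value is approached by feasible points
    ((MGSTA.feasibleSet γ α ρ A E C D B H J ζ₀ σ₀ z₀).Nonempty →
      ∀ ε > 0, ∃ p ∈ MGSTA.feasibleSet γ α ρ A E C D B H J ζ₀ σ₀ z₀,
        p.1 < sInf (Prod.fst '' MGSTA.feasibleSet γ α ρ A E C D B H J ζ₀ σ₀ z₀) + ε) ∧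
    -- every feasible point yields stabilizing gains with guaranteed cost `θ`
    ∀ θ Q X Y W z, (θ, Q, X, Y, W, z) ∈ MGSTA.feasibleSet γ α ρ A E C D B H J ζ₀ σ₀ z₀ →
      IsUnit Q.det ∧ IsUnit X.det ∧
      ∀ A' E' C' D' B', (A', E', C', D', B') ∈ MGSTA.polytope A E C D B →
        IsUnit (B' * (Y * X⁻¹).toCols₂).det ∧
        ∀ f : ℝ → EuclideanSpace ℝ (Fin n),
          MGSTA.IsDisturbance (MGSTA.disturbanceBound γ B' (Y * X⁻¹)) f →
          MGSTA.IsGloballyAsymptoticallyStable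
            (MGSTA.closedLoop α A' E' C' D' B' (W * Q⁻¹) (Y * X⁻¹) f)
            (MGSTA.shifted B' (Y * X⁻¹) f) ∧
          MGSTA.HasGuaranteedCost
            (MGSTA.closedLoop α A' E' C' D' B' (W * Q⁻¹) (Y * X⁻¹) f)
            (MGSTA.shifted B' (Y * X⁻¹) f) H J (W * Q⁻¹) ζ₀ σ₀ z₀ θ := by
  refine ⟨MGSTA.convex_feasibleSet γ α ρ A E C D B H J ζ₀ σ₀ z₀, fun hne ε hε => ?_,
    fun θ Q X Y W z hfeas => ?_⟩
  · obtain ⟨_, ⟨p, hp, rfl⟩, hlt⟩ := exists_lt_of_csInf_lt (hne.image Prod.fst)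
      (lt_add_of_pos_right (sInf (Prod.fst '' _)) hε)
    exact ⟨p, hp, hlt⟩
  · obtain ⟨h1, h2, h3, h4, h5⟩ := MGSTA.mem_feasibleSet_iff.1 hfeas
    have hQ := MGSTA.posDef_of_bordered h4
    have hX := MGSTA.posDef_of_bordered h5
    refine ⟨(Matrix.isUnit_iff_isUnit_det _).1 hQ.isUnit,
      (Matrix.isUnit_iff_isUnit_det _).1 hX.isUnit, fun A' E' C' D' B' hmem => ?_⟩
    obtain ⟨k1, k2, k3⟩ := MGSTA.posDef_of_mem_polytope γ α ρ h1 h2 h3 hmem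
    obtain ⟨P, hP, hh, hbz, hbx⟩ := MGSTA.exists_certificate hγ hα hρ hQ hX k1 k2 k3
    refine ⟨hP.isUnit_det, fun f hf =>
      ⟨MGSTA.isGloballyAsymptoticallyStable_of_certificate hP hf,
        MGSTA.hasGuaranteedCost_of_certificate hP hh hf ?_⟩⟩
    refine max_le ?_ ?_
    · rw [hbz]
      exact MGSTA.bordered_le hQ h4
    · rw [hbx, MGSTA.vec_chi]
      exact MGSTA.bordered_le hX h5
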